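/- Let $N\in\{2,3\}$, $S=\{1,\dots,N+1\}$, and let $p_1,\dots,p_{N+1}$ be the vertices of a (nondegenerate) closed $N$-simplex $\tilde K\subset\mathbb{R}^N$. Put $\psi_i(z)=(z+p_i)/2$ for $i\in S$, $\psi_w=\psi_{w_1}\circ\cdots\circ\psi_{w_m}$ for a finite word $w=w_1\cdots w_m$ over $S$ (including the empty word, $\psi_\emptyset=\mathrm{id}$), let $K=\bigcap_{m\ge0}\bigcup_{|w|=m}\psi_w(\tilde K)$ be the $N$-dimensional Sierpinski gasket, and let $K_w=\psi_w(K)$. For $f\in C(K)$ (real-valued) put $$\mathcal{E}_*(f)=\lim_{m\to\infty}\Bigl(\tfrac{N+3}{N+1}\Bigr)^m\sum_{|w|=m}\tfrac12\sum_{k,l\in S}\bigl(f(\psi_w(p_k))-f(\psi_w(p_l))\bigr)^2\in[0,\infty]$$ (the limit of a nondecreasing sequence), $\mathcal{F}=\{f\in C(K):\mathcal{E}_*(f)<\infty\}$, and $\mathcal{E}(f,g)=\frac12\{\mathcal{E}_*(f+g)-\mathcal{E}_*(f)-\mathcal{E}_*(g)\}$ for $f,g\in\mathcal{F}$. The energy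 measure $\nu_f$ of $f\in\mathcal{F}$ is the unique finite Borel measure on $K$ with $\int_K g\,d\nu_f=2\mathcal{E}(f,fg)-\mathcal{E}(f^2,g)$ for all $g\in\mathcal{F}$. A function $h\in\mathcal{F}$ is harmonic if $\mathcal{E}(h,h)\le\mathcal{E}(f,f)$ for all $f\in\mathcal{F}$ that agree with $h$ on $\{p_1,\dots,p_{N+1}\}$; each assignment of values on $\{p_1,\dots,p_{N+1}\}$ extends to exactly one harmonic function. Let $h_k$ be the harmonic function with $h_k(p_k)=1$ and $h_k(p_l)=0$ for $l\ne k$, and let $\nu=\sum_{k\in S}\nu_{h_k}$ be the Kusuoka measure. Let $w$ be a finite word over $S$, let $i,j\in S$ be distinct, and let $h$ be harmonic. Denote by $\overline{p_ip_j}$ the closed segment from $p_i$ to $p_j$ and, for $\omega=\omega_1\omega_2\cdots\in\{i,j\}^{\mathbb{N}}$, put $[\omega]_n=\omega_1\cdots\omega_n$. For every $\omega\in\{i,j\}^{\mathbb{N}}$ one has $\bigcap_{n\ge0}K_{w[\omega]_n}=\{\Psi(\omega)\}$ for a point $\Psi(\omega)\in\psi_w(\overline{p_ip_j})$, and $\Psi\colon\{i,j\}^{\mathbb{N}}\to\psi_w(\overline{p_ip_j})$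 is surjective. **Theorem 2.4.** For every $\omega\in\{i,j\}^{\mathbb{N}}$ the limit $$\delta_h(\omega)=\lim_{n\to\infty}\frac{\nu_h(K_{w[\omega]_n})}{\nu(K_{w[\omega]_n})}$$ exists in $\mathbb{R}$. It depends only on the point $\Psi(\omega)$, so that the function $\frac{\delta\nu_h}{\delta\nu}(x)=\delta_h(\omega)$ for $x=\Psi(\omega)$ is well defined on $\psi_w(\overline{p_ip_j})$. This function is $\log_2(1+N^{-1})$-Hölder continuous on $\psi_w(\overline{p_ip_j})$ with respect to the Euclidean distance: there is a constant $C$ with $$\Bigl|\tfrac{\delta\nu_h}{\delta\nu}(x)-\tfrac{\delta\nu_h}{\delta\nu}(y)\Bigr|\le C\,|x-y|^{\log_2(1+N^{-1})}\qquad\text{for all }x,y\in\psi_w(\overline{p_ip_j}).$$ -/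

import Mathlib

open Filter Topology
open scoped ENNReal

namespace SierpinskiGasket

variable {N : ℕ} (p : Fin (N + 1) → EuclideanSpace ℝ (Fin N))

/-- The contraction `ψ_i(z) = (z + p_i) / 2`. -/
noncomputable def psi (i : Fin (N + 1)) (z : EuclideanSpace ℝ (Fin N)) :
    EuclideanSpace ℝ (Fin N) :=
  (1 / 2 : ℝ) • (z + p i)

/-- `ψ_w = ψ_{w_1} ∘ ⋯ ∘ ψ_{w_m}` for a finite word `w = w_1 ⋯ w_m`; `ψ_∅` is the identity. -/
noncomputable def psiWord (w : List (Fin (N + 1))) (z : EuclideanSpace ℝ (Fin N)) :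
    EuclideanSpace ℝ (Fin N) :=
  w.foldr (psi p) z

/-- The gasket `K = ⋂_m ⋃_{|w| = m} ψ_w(conv{p_1, …, p_{N+1}})`. Words of length `m` are written
as `List.ofFn w` with `w : Fin m → S`. -/
def gasket : Set (EuclideanSpace ℝ (Fin N)) :=
  ⋂ m : ℕ, ⋃ w : Fin m → Fin (N + 1),
    psiWord p (List.ofFn w) '' convexHull ℝ (Set.range p)

/-- The cell `K_w = ψ_w(K)`. -/
def cell (w : List (Fin (N + 1))) : Set (EuclideanSpace ℝ (Fin N)) :=
  psiWord p w '' gasket p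

/-- The edge `ψ_w(p_i p_j)`, the image of the closed segment from `p_i` to `p_j`. -/
def edge (w : List (Fin (N + 1))) (i j : Fin (N + 1)) : Set (EuclideanSpace ℝ (Fin N)) :=
  psiWord p w '' segment ℝ (p i) (p j)

theorem vertex_mem_gasket (i : Fin (N + 1)) : p i ∈ gasket p := by
  have hfix : psi p i (p i) = p i := by
    simp only [psi, ← two_smul ℝ (p i), smul_smul]
    norm_num
  have hrep : ∀ m : ℕ, psiWord p (List.replicate m i) (p i) = p i := by
    intro m
    induction m with
    | zero => rfl
    | succ m ih =>
      have : psiWord p (List.replicate (m + 1) i) (p i)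
          = psi p i (psiWord p (List.replicate m i) (p i)) := rfl
      rw [this, ih, hfix]
  refine Set.mem_iInter.2 fun m => Set.mem_iUnion.2 ⟨fun _ => i, p i, ?_, ?_⟩
  · exact subset_convexHull ℝ _ ⟨i, rfl⟩
  · rw [List.ofFn_const]
    exact hrep m

theorem psi_mem_gasket (i : Fin (N + 1)) {z : EuclideanSpace ℝ (Fin N)} (hz : z ∈ gasket p) :
    psi p i z ∈ gasket p := by
  refine Set.mem_iInter.2 fun m => Set.mem_iUnion.2 ?_
  cases m with
  | zero =>
    obtain ⟨w, y, hy, hyz⟩ := Set.mem_iUnion.1 (Set.mem_iInter.1 hz 0)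
    have hyz' : y = z := by simpa [psiWord] using hyz
    subst hyz'
    refine ⟨w, psi p i y, ?_, by simp [psiWord]⟩
    have hi : p i ∈ convexHull ℝ (Set.range p) := subset_convexHull ℝ _ ⟨i, rfl⟩
    have := (convex_convexHull ℝ (Set.range p)) hy hi
      (show (0 : ℝ) ≤ 1 / 2 by norm_num) (show (0 : ℝ) ≤ 1 / 2 by norm_num) (by norm_num)
    simpa only [psi, smul_add] using this
  | succ m =>
    obtain ⟨w, y, hy, hyz⟩ := Set.mem_iUnion.1 (Set.mem_iInter.1 hz m)
    refine ⟨Fin.cons i w, y, hy, ?_⟩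
    rw [List.ofFn_cons, ← hyz]
    rfl

theorem psiWord_mem_gasket (w : List (Fin (N + 1))) {z : EuclideanSpace ℝ (Fin N)}
    (hz : z ∈ gasket p) : psiWord p w z ∈ gasket p := by
  induction w with
  | nil => exact hz
  | cons i w ih => exact psi_mem_gasket p i ih

/-- The point `ψ_w(p_i)` of `V_{|w|}`, as a point of `K`. -/
noncomputable def vertex (w : List (Fin (N + 1))) (i : Fin (N + 1)) : gasket p :=
  ⟨psiWord p w (p i), psiWord_mem_gasket p w (vertex_mem_gasket p i)⟩

/-- `Q_0(u, u) = (1/2) ∑_{i,j} (u_i - u_j)^2`. -/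
noncomputable def Q0 (u : Fin (N + 1) → ℝ) : ℝ :=
  (1 / 2) * ∑ i, ∑ j, (u i - u j) ^ 2

/-- `Q_m(f, f) = ∑_{|w| = m} Q_0(f ∘ ψ_w|_{V_0}, f ∘ ψ_w|_{V_0})`. -/
noncomputable def Q (m : ℕ) (f : C(gasket p, ℝ)) : ℝ :=
  ∑ w : Fin m → Fin (N + 1), Q0 fun i => f (vertex p (List.ofFn w) i)

/-- `𝓔_*(f, f) ∈ [0, ∞]`: the limit of the nondecreasing sequence
`((N + 3) / (N + 1))^m Q_m(f, f)`, that is, its supremum. -/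
noncomputable def energy (f : C(gasket p, ℝ)) : ℝ≥0∞ :=
  ⨆ m : ℕ, ENNReal.ofReal ((((N : ℝ) + 3) / ((N : ℝ) + 1)) ^ m * Q p m f)

/-- The domain `𝓕` of the standard Dirichlet form. -/
def domain : Set C(gasket p, ℝ) :=
  {f | energy p f < ∞}

/-- The standard Dirichlet form `𝓔(f, g)`, by polarization; meant for `f, g ∈ 𝓕`. -/
noncomputable def form (f g : C(gasket p, ℝ)) : ℝ :=
  (1 / 2) * ((energy p (f + g)).toReal - (energy p f).toReal - (energy p g).toReal)

/-- `h` is harmonic: it lies in `𝓕` and minimizes the energy among all functions of `𝓕` with the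
same values on `V_0 = {p_1, …, p_{N+1}}`. -/
def IsHarmonic (h : C(gasket p, ℝ)) : Prop :=
  h ∈ domain p ∧
    ∀ f ∈ domain p, (∀ i, f (vertex p [] i) = h (vertex p [] i)) → form p h h ≤ form p f f

/-- The harmonic function `ι(u)` with boundary values `u` on `V_0`. -/
noncomputable def harmonicExt (u : Fin (N + 1) → ℝ) : C(gasket p, ℝ) :=
  Classical.epsilon fun h => IsHarmonic p h ∧ ∀ i, h (vertex p [] i) = u i

/-- `μ` is the energy measure of `f`: the finite Borel measure on `K` with
`∫ g dμ = 2 𝓔(f, f g) - 𝓔(f², g)` for every `g ∈ 𝓕`. -/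
def IsEnergyMeasure (f : C(gasket p, ℝ)) (μ : MeasureTheory.Measure (gasket p)) : Prop :=
  MeasureTheory.IsFiniteMeasure μ ∧
    ∀ g ∈ domain p, ∫ x, g x ∂μ = 2 * form p f (f * g) - form p (f ^ 2) g

/-- The energy measure `ν_f` of `f ∈ 𝓕`. -/
noncomputable def energyMeasure (f : C(gasket p, ℝ)) : MeasureTheory.Measure (gasket p) :=
  Classical.epsilon (IsEnergyMeasure p f)

/-- The Kusuoka measure `ν = ∑_k ν_{h_k}`, where `h_k = ι(e_k)`. -/
noncomputable def kusuokaMeasure : MeasureTheory.Measure (gasket p) :=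
  ∑ k : Fin (N + 1), energyMeasure p (harmonicExt p (Pi.single k 1))

/-- The ratio `ν_h(K_w) / ν(K_w)`. -/
noncomputable def cellRatio (h : C(gasket p, ℝ)) (w : List (Fin (N + 1))) : ℝ :=
  (energyMeasure p h).real (Subtype.val ⁻¹' cell p w) /
    (kusuokaMeasure p).real (Subtype.val ⁻¹' cell p w)

/-- The initial word `[ω]_n = ω_1 ⋯ ω_n` of an infinite sequence. -/
def initialWord (ω : ℕ → Fin (N + 1)) (n : ℕ) : List (Fin (N + 1)) :=
  List.ofFn fun k : Fin n => ω k

/-- The set `{i, j}^ℕ` of sequences with values in `{i, j}`. -/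
def edgeSeq (i j : Fin (N + 1)) : Set (ℕ → Fin (N + 1)) :=
  {ω | ∀ n, ω n = i ∨ ω n = j}

/-- `Ψ(ω) = x` relative to the word `w`: `⋂_n K_{w[ω]_n} = {x}`. -/
def IsCodedBy (w : List (Fin (N + 1))) (ω : ℕ → Fin (N + 1)) (x : EuclideanSpace ℝ (Fin N)) :
    Prop :=
  ⋂ n : ℕ, cell p (w ++ initialWord ω n) = {x}

end SierpinskiGasket

/-! On the vertices of `K_w` the harmonic function with boundary values `u` takes the values `restr
w u`, where `restr w` is a product of the linear maps `harm i`. Renormalized energy is additive over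
cells, so `ν_h(K_w)` equals `2 ((N+3)/(N+1))^|w| Q0 (restr w u)` (`energyMeasure_harmFun`). The
prefactor cancels in the ratio, and the theorem becomes a statement about products of matrices
(`cellRatio_eq`).

Fix an edge `{i, j}`. Modulo constants a vector `u` is described by `X = u i - m`, `Y = u j - m`,
with `m` the mean over the other vertices, and by the differences of the values off the edge. Both
`harm i` and `harm j` act on `(X, Y)` alone and divide the off-edge differences by `N + 3`. They
pull the linear form `X - s Y` back to a multiple of the form with slope `slopeStep i a s`
(`edgeForm_harm`). For both letters this map of slopes sends `[1/N, N]` to itself and contracts `log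
s` by the factor `N/(N+1)` (`abs_log_slopeStep_sub_le`), so every sequence `ω` determines a limiting
slope.

On the kernel of the limiting form everything decays by `(N/(N+1))^n` relative to the growth of the
form itself. Hence `Q0` along `ω` is asymptotically the square of that form times a quantity
independent of `u` (`tendsto_Q0_ratio`), and the ratio of measures converges to a smooth function of
the log slope (`tendsto_cellRatio`, `exists_lipschitz_slopeDensity_exp`).

Dropping a common first letter doubles Euclidean distance, while restoring it contracts log slopes
by `N/(N+1) = 2^(-α)` with `α = log_2(1 + 1/N)`. The two codes of a junction point have the same
slope, so the log slope is `α`-Hölder in the coded point (`exists_holder_logSlope`). This also shows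
that it depends on the point only. The argument works for every `N ≥ 2`. -/

namespace SierpinskiGasket

/-! ### Linear algebra of the energy form on a simplex and of harmonic subdivision. -/

section Algebra

variable {N : ℕ}

theorem Q0_eq (u : Fin (N + 1) → ℝ) :
    Q0 u = ((N : ℝ) + 1) * ∑ k, u k ^ 2 - (∑ k, u k) ^ 2 := by
  have h : ∑ i, ∑ j, (u i - u j) ^ 2
      = 2 * (((N : ℝ) + 1) * ∑ k, u k ^ 2) - 2 * (∑ k, u k) ^ 2 := by
    simp only [sub_sq, Finset.sum_add_distrib, Finset.sum_sub_distrib, Finset.sum_const,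
      Finset.card_univ, Fintype.card_fin, nsmul_eq_mul, ← Finset.mul_sum, ← Finset.sum_mul]
    push_cast
    ring
  rw [Q0, h]
  ring

theorem Q0_nonneg (u : Fin (N + 1) → ℝ) : 0 ≤ Q0 u := by
  unfold Q0
  positivity

theorem sq_sub_le_Q0 (u : Fin (N + 1) → ℝ) (k l : Fin (N + 1)) : (u k - u l) ^ 2 ≤ Q0 u := by
  by_cases hkl : k = l
  · simpa [hkl] using Q0_nonneg u
  have h1 : (u k - u l) ^ 2 ≤ ∑ j, (u k - u j) ^ 2 :=
    Finset.single_le_sum (f := fun j => (u k - u j) ^ 2) (fun _ _ => sq_nonneg _)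
      (Finset.mem_univ l)
  have h2 : (u l - u k) ^ 2 ≤ ∑ j, (u l - u j) ^ 2 :=
    Finset.single_le_sum (f := fun j => (u l - u j) ^ 2) (fun _ _ => sq_nonneg _)
      (Finset.mem_univ k)
  have h3 : ∑ i ∈ {k, l}, ∑ j, (u i - u j) ^ 2 ≤ ∑ i, ∑ j, (u i - u j) ^ 2 :=
    Finset.sum_le_sum_of_subset_of_nonneg (Finset.subset_univ _)
      fun _ _ _ => Finset.sum_nonneg fun _ _ => sq_nonneg _
  rw [Finset.sum_pair hkl] at h3
  unfold Q0
  nlinarith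

theorem abs_sub_le_sqrt_Q0 (u : Fin (N + 1) → ℝ) (k l : Fin (N + 1)) :
    |u k - u l| ≤ √(Q0 u) :=
  Real.abs_le_sqrt (sq_sub_le_Q0 u k l)

theorem Q0_eq_zero_imp {u : Fin (N + 1) → ℝ} (h : Q0 u = 0) (k l : Fin (N + 1)) : u k = u l := by
  have := sq_sub_le_Q0 u k l
  rw [h] at this
  exact sub_eq_zero.1 (pow_eq_zero_iff two_ne_zero |>.1 (le_antisymm this (sq_nonneg _)))

theorem Q0_le (u : Fin (N + 1) → ℝ) {c : ℝ} (h : ∀ k l, (u k - u l) ^ 2 ≤ c) :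
    Q0 u ≤ ((N : ℝ) + 1) ^ 2 * c := by
  have hc : 0 ≤ c := (sq_nonneg _).trans (h 0 0)
  have : ∑ i, ∑ j, (u i - u j) ^ 2 ≤ ∑ _i : Fin (N + 1), ∑ _j : Fin (N + 1), c :=
    Finset.sum_le_sum fun i _ => Finset.sum_le_sum fun j _ => h i j
  simp only [Finset.sum_const, Finset.card_univ, Fintype.card_fin, nsmul_eq_mul] at this
  push_cast at this
  unfold Q0
  nlinarith [mul_nonneg (sq_nonneg ((N : ℝ) + 1)) hc]

/-- The polar form of `Q0`. -/
noncomputable def B0 (u v : Fin (N + 1) → ℝ) : ℝ :=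
  ((N : ℝ) + 1) * ∑ k, u k * v k - (∑ k, u k) * ∑ k, v k

theorem Q0_add (u v : Fin (N + 1) → ℝ) : Q0 (u + v) = Q0 u + 2 * B0 u v + Q0 v := by
  simp only [Q0_eq, B0, Pi.add_apply, add_sq, Finset.sum_add_distrib]
  have : ∑ k, 2 * u k * v k = 2 * ∑ k, u k * v k := by
    simp only [Finset.mul_sum, mul_assoc]
  rw [this]
  ring

theorem Q0_smul (c : ℝ) (u : Fin (N + 1) → ℝ) : Q0 (c • u) = c ^ 2 * Q0 u := by
  simp only [Q0, Pi.smul_apply, smul_eq_mul, ← mul_sub, mul_pow, ← Finset.mul_sum]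
  ring

theorem B0_smul_left (c : ℝ) (u v : Fin (N + 1) → ℝ) : B0 (c • u) v = c * B0 u v := by
  simp only [B0, Pi.smul_apply, smul_eq_mul, mul_assoc, ← Finset.mul_sum]
  ring

theorem B0_sq_le (u v : Fin (N + 1) → ℝ) : B0 u v ^ 2 ≤ Q0 u * Q0 v := by
  have h : ∀ t : ℝ, 0 ≤ Q0 u * (t * t) + 2 * B0 u v * t + Q0 v := by
    intro t
    have := Q0_nonneg (t • u + v)
    rw [Q0_add, Q0_smul, B0_smul_left] at this
    linarith
  have := discrim_le_zero h
  unfold discrim at this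
  nlinarith

theorem Q0_add_le (u v : Fin (N + 1) → ℝ) : Q0 (u + v) ≤ 2 * Q0 u + 2 * Q0 v := by
  have h1 := Q0_add u v
  have h2 := Q0_nonneg (u + (-1 : ℝ) • v)
  rw [Q0_add, Q0_smul] at h2
  have h3 : B0 u ((-1 : ℝ) • v) = - B0 u v := by
    simp only [B0, Pi.smul_apply, smul_eq_mul, neg_one_mul, mul_neg, Finset.sum_neg_distrib]
    ring
  rw [h3] at h2
  linarith

/-- The values on `ψ_i(V_0)` of the harmonic function with values `u` on `V_0`. -/
noncomputable def harm (i : Fin (N + 1)) : (Fin (N + 1) → ℝ) →ₗ[ℝ] (Fin (N + 1) → ℝ) where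
  toFun u k := if k = i then u i else (u i + u k + ∑ l, u l) / ((N : ℝ) + 3)
  map_add' u v := by
    ext k
    by_cases h : k = i
    · simp [h]
    · simp only [h, Pi.add_apply, if_false, Finset.sum_add_distrib]
      ring
  map_smul' c u := by
    ext k
    by_cases h : k = i
    · simp [h]
    · simp only [h, Pi.smul_apply, if_false, smul_eq_mul, ← Finset.mul_sum, RingHom.id_apply]
      ring

theorem harm_self (i : Fin (N + 1)) (u : Fin (N + 1) → ℝ) : harm i u i = u i := by
  simp [harm]

theorem harm_of_ne {i k : Fin (N + 1)} (h : k ≠ i) (u : Fin (N + 1) → ℝ) :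
    harm i u k = (u i + u k + ∑ l, u l) / ((N : ℝ) + 3) := by
  simp [harm, h]

theorem harm_symm (i k : Fin (N + 1)) (u : Fin (N + 1) → ℝ) : harm i u k = harm k u i := by
  by_cases h : k = i
  · rw [h]
  · rw [harm_of_ne h, harm_of_ne (Ne.symm h), add_comm (u i)]

theorem harm_eq (i k : Fin (N + 1)) (u : Fin (N + 1) → ℝ) :
    harm i u k = (u i + u k + ∑ l, u l) / ((N : ℝ) + 3)
      + if k = i then (((N : ℝ) + 1) * u i - ∑ l, u l) / ((N : ℝ) + 3) else 0 := by
  have : (N : ℝ) + 3 ≠ 0 := by positivity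
  by_cases h : k = i
  · subst h
    rw [harm_self, if_pos rfl]
    field_simp
    ring
  · rw [harm_of_ne h, if_neg h, add_zero]

theorem sum_harm (i : Fin (N + 1)) (u : Fin (N + 1) → ℝ) :
    ∑ k, harm i u k = ((N : ℝ) + 1) * (2 * u i + ∑ l, u l) / ((N : ℝ) + 3) := by
  have : (N : ℝ) + 3 ≠ 0 := by positivity
  simp only [harm_eq, Finset.sum_add_distrib, ← Finset.sum_div, Finset.sum_ite_eq',
    Finset.mem_univ, if_true, Finset.sum_const, Finset.card_univ, Fintype.card_fin, nsmul_eq_mul]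
  push_cast
  field_simp
  ring

theorem sum_harm_sq (i : Fin (N + 1)) (u : Fin (N + 1) → ℝ) :
    ∑ k, harm i u k ^ 2 =
      (((N : ℝ) + 1) * (u i + ∑ l, u l) ^ 2 + 2 * (u i + ∑ l, u l) * (∑ l, u l) + ∑ l, u l ^ 2
        - (2 * u i + ∑ l, u l) ^ 2) / ((N : ℝ) + 3) ^ 2 + u i ^ 2 := by
  have h3 : (N : ℝ) + 3 ≠ 0 := by positivity
  have h : ∀ k, harm i u k ^ 2 = (u i + ∑ l, u l + u k) ^ 2 / ((N : ℝ) + 3) ^ 2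
      + if k = i then u i ^ 2 - (2 * u i + ∑ l, u l) ^ 2 / ((N : ℝ) + 3) ^ 2 else 0 := by
    intro k
    by_cases h : k = i
    · subst h
      rw [harm_self, if_pos rfl]
      ring
    · rw [harm_of_ne h, if_neg h, add_zero, div_pow]
      ring
  simp only [h, Finset.sum_add_distrib, ← Finset.sum_div, Finset.sum_ite_eq',
    Finset.mem_univ, if_true, add_sq, Finset.sum_const, Finset.card_univ, Fintype.card_fin,
    nsmul_eq_mul, ← Finset.mul_sum]
  push_cast
  field_simp
  ring

theorem Q0_harm (i : Fin (N + 1)) (u : Fin (N + 1) → ℝ) :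
    Q0 (harm i u) = ((N : ℝ) + 1) / ((N : ℝ) + 3) ^ 2 *
      (((N : ℝ) + 1) * ((N : ℝ) + 2) * u i ^ 2 - 2 * ((N : ℝ) + 2) * (∑ l, u l) * u i
        + ((∑ l, u l ^ 2) + (∑ l, u l) ^ 2)) := by
  have h3 : (N : ℝ) + 3 ≠ 0 := by positivity
  rw [Q0_eq, sum_harm, sum_harm_sq]
  field_simp
  ring

theorem sum_Q0_harm (u : Fin (N + 1) → ℝ) :
    ∑ i, Q0 (harm i u) = ((N : ℝ) + 1) / ((N : ℝ) + 3) * Q0 u := by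
  have h3 : (N : ℝ) + 3 ≠ 0 := by positivity
  simp only [Q0_harm]
  rw [Q0_eq]
  simp only [← Finset.mul_sum, Finset.sum_add_distrib, Finset.sum_sub_distrib,
    Finset.sum_const, Finset.card_univ, Fintype.card_fin, nsmul_eq_mul]
  push_cast
  field_simp
  ring

/-- Modulo constants `harm i` has eigenvalues `(N+1)/(N+3)` and `1/(N+3)`, and the larger one
governs. The defect is a positive multiple of the Cauchy–Schwarz defect of `u` over the letters
other than `i`. -/
theorem Q0_harm_le (i : Fin (N + 1)) (u : Fin (N + 1) → ℝ) :
    Q0 (harm i u) ≤ (((N : ℝ) + 1) / ((N : ℝ) + 3)) ^ 2 * Q0 u := by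
  have h3 : (N : ℝ) + 3 ≠ 0 := by positivity
  have hcs : (∑ l ∈ Finset.univ.erase i, u l) ^ 2
      ≤ (N : ℝ) * ∑ l ∈ Finset.univ.erase i, u l ^ 2 := by
    have := sq_sum_le_card_mul_sum_sq (s := Finset.univ.erase i) (f := u)
    simpa [Finset.card_erase_of_mem] using this
  have h1 : ∑ l, u l = u i + ∑ l ∈ Finset.univ.erase i, u l :=
    (Finset.add_sum_erase _ u (Finset.mem_univ i)).symm
  have h2 : ∑ l, u l ^ 2 = u i ^ 2 + ∑ l ∈ Finset.univ.erase i, u l ^ 2 :=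
    (Finset.add_sum_erase _ (fun l => u l ^ 2) (Finset.mem_univ i)).symm
  rw [Q0_harm, Q0_eq, h1, h2]
  generalize ∑ l ∈ Finset.univ.erase i, u l = s at *
  generalize ∑ l ∈ Finset.univ.erase i, u l ^ 2 = q at *
  have key : (((N : ℝ) + 1) / ((N : ℝ) + 3)) ^ 2 * (((N : ℝ) + 1) * (u i ^ 2 + q) - (u i + s) ^ 2)
      - ((N : ℝ) + 1) / ((N : ℝ) + 3) ^ 2 *
      (((N : ℝ) + 1) * ((N : ℝ) + 2) * u i ^ 2 - 2 * ((N : ℝ) + 2) * (u i + s) * u i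
        + ((u i ^ 2 + q) + (u i + s) ^ 2))
      = ((N : ℝ) + 1) * ((N : ℝ) + 2) / ((N : ℝ) + 3) ^ 2 * ((N : ℝ) * q - s ^ 2) := by
    field_simp
    ring
  have : 0 ≤ ((N : ℝ) + 1) * ((N : ℝ) + 2) / ((N : ℝ) + 3) ^ 2 * ((N : ℝ) * q - s ^ 2) :=
    mul_nonneg (by positivity) (by linarith)
  linarith

/-- Euler–Lagrange equation: `d` is a perturbation of the values on `V_1` that vanishes on `V_0`.
Its symmetry says that the cells `k` and `l` share the point `ψ_k(p_l) = ψ_l(p_k)`. The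
contributions of `(k, l)` and `(l, k)` cancel. -/
theorem sum_B0_harm_eq_zero (u : Fin (N + 1) → ℝ) (d : Fin (N + 1) → Fin (N + 1) → ℝ)
    (hd : ∀ k l, d k l = d l k) (hd0 : ∀ k, d k k = 0) : ∑ k, B0 (harm k u) (d k) = 0 := by
  have h3 : (N : ℝ) + 3 ≠ 0 := by positivity
  have h : ∀ k, B0 (harm k u) (d k)
      = ∑ l, ((N : ℝ) + 1) / ((N : ℝ) + 3) * ((u l - u k) * d k l) := by
    intro k
    rw [B0, Finset.mul_sum, Finset.mul_sum, ← Finset.sum_sub_distrib]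
    refine Finset.sum_congr rfl fun l _ => ?_
    by_cases hkl : l = k
    · subst hkl
      simp [hd0]
    · rw [harm_of_ne hkl, sum_harm]
      field_simp
      ring
  have hs : ∑ k, ∑ l, (u l - u k) * d k l = 0 := by
    have h1 : ∑ k, ∑ l, (u l - u k) * d k l = ∑ k, ∑ l, (u k - u l) * d k l := by
      rw [Finset.sum_comm]
      exact Finset.sum_congr rfl fun k _ => Finset.sum_congr rfl fun l _ => by rw [hd l k]
    have h2 : ∑ k, ∑ l, (u l - u k) * d k l = -∑ k, ∑ l, (u k - u l) * d k l := by
      simp only [← Finset.sum_neg_distrib]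
      exact Finset.sum_congr rfl fun k _ => Finset.sum_congr rfl fun l _ => by ring
    linarith
  simp only [h, ← Finset.mul_sum, hs, mul_zero]

/-- Among all the values on `V_1` with given restriction to `V_0`, the harmonic ones minimize the
energy. -/
theorem sum_Q0_eq_add (v : Fin (N + 1) → Fin (N + 1) → ℝ) (hv : ∀ k l, v k l = v l k) :
    ∑ k, Q0 (v k) = ((N : ℝ) + 1) / ((N : ℝ) + 3) * Q0 (fun k => v k k)
      + ∑ k, Q0 (v k - harm k fun l => v l l) := by
  set u : Fin (N + 1) → ℝ := fun k => v k k with hu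
  have hcross := sum_B0_harm_eq_zero u (fun k => v k - harm k u)
    (fun k l => by simp [hv k l, harm_symm k l]) (fun k => by simp [harm_self, hu])
  have h : ∀ k, Q0 (v k) = Q0 (harm k u) + 2 * B0 (harm k u) (v k - harm k u)
      + Q0 (v k - harm k u) := fun k => by rw [← Q0_add, add_sub_cancel]
  simp only [h, Finset.sum_add_distrib, ← Finset.mul_sum, hcross, sum_Q0_harm]
  ring

theorem eq_harm_of_sum_Q0_le (v : Fin (N + 1) → Fin (N + 1) → ℝ) (hv : ∀ k l, v k l = v l k)
    (h : ∑ k, Q0 (v k) ≤ ((N : ℝ) + 1) / ((N : ℝ) + 3) * Q0 (fun k => v k k)) (k : Fin (N + 1)) :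
    v k = harm k fun l => v l l := by
  rw [sum_Q0_eq_add v hv] at h
  have h0 : ∑ k, Q0 (v k - harm k fun l => v l l) = 0 :=
    le_antisymm (by linarith) (Finset.sum_nonneg fun _ _ => Q0_nonneg _)
  have hk := (Finset.sum_eq_zero_iff_of_nonneg fun _ _ => Q0_nonneg _).1 h0 k (Finset.mem_univ k)
  ext l
  have := Q0_eq_zero_imp hk l k
  simp only [Pi.sub_apply, harm_self, sub_self] at this
  linarith

/-- Together with finite dimension this makes every `restr w` bijective: any boundary values on a
small cell come from a global harmonic function. -/
theorem harm_injective (i : Fin (N + 1)) :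
    Function.Injective (harm i : (Fin (N + 1) → ℝ) →ₗ[ℝ] _) := by
  rw [← LinearMap.ker_eq_bot, LinearMap.ker_eq_bot']
  intro u hu
  have h3 : (N : ℝ) + 3 ≠ 0 := by positivity
  have hi : u i = 0 := by rw [← harm_self i u, hu]; rfl
  have hs := sum_harm i u
  rw [hu, hi] at hs
  have hσ : ∑ l, u l = 0 := by
    have h1 : (N : ℝ) + 1 ≠ 0 := by positivity
    field_simp at hs
    exact (by simpa using hs.symm : (N : ℝ) + 1 = 0 ∨ ∑ l, u l = 0).resolve_left h1
  ext k
  by_cases hk : k = i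
  · simpa [hk] using hi
  · have := congrFun hu k
    rw [harm_of_ne hk, hi, hσ] at this
    simpa [h3] using this

/-- The values on `ψ_w(V_0)` of the harmonic function with values `u` on `V_0`. -/
noncomputable def restr : List (Fin (N + 1)) → (Fin (N + 1) → ℝ) →ₗ[ℝ] (Fin (N + 1) → ℝ)
  | [] => LinearMap.id
  | i :: w => restr w ∘ₗ harm i

@[simp] theorem restr_nil (u : Fin (N + 1) → ℝ) : restr [] u = u := rfl

@[simp] theorem restr_cons (i : Fin (N + 1)) (w : List (Fin (N + 1))) (u : Fin (N + 1) → ℝ) :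
    restr (i :: w) u = restr w (harm i u) := rfl

theorem restr_append (v w : List (Fin (N + 1))) (u : Fin (N + 1) → ℝ) :
    restr (v ++ w) u = restr w (restr v u) := by
  induction v generalizing u with
  | nil => rfl
  | cons i v ih => exact ih _

theorem restr_injective (w : List (Fin (N + 1))) :
    Function.Injective (restr w : (Fin (N + 1) → ℝ) →ₗ[ℝ] _) := by
  induction w with
  | nil => exact Function.injective_id
  | cons i w ih => exact ih.comp (harm_injective i)

theorem restr_surjective (w : List (Fin (N + 1))) :
    Function.Surjective (restr w : (Fin (N + 1) → ℝ) →ₗ[ℝ] _) :=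
  LinearMap.injective_iff_surjective.1 (restr_injective w)

theorem Q0_restr_le (w : List (Fin (N + 1))) (u : Fin (N + 1) → ℝ) :
    Q0 (restr w u) ≤ (((N : ℝ) + 1) / ((N : ℝ) + 3)) ^ (2 * w.length) * Q0 u := by
  induction w generalizing u with
  | nil => simp
  | cons i w ih =>
    refine (ih _).trans ?_
    rw [List.length_cons, mul_add, pow_add, mul_assoc]
    exact mul_le_mul_of_nonneg_left (Q0_harm_le i u) (by positivity)

theorem sqrt_Q0_restr_le (w : List (Fin (N + 1))) (u : Fin (N + 1) → ℝ) :
    √(Q0 (restr w u)) ≤ (((N : ℝ) + 1) / ((N : ℝ) + 3)) ^ w.length * √(Q0 u) := by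
  refine (Real.sqrt_le_sqrt (Q0_restr_le w u)).trans ?_
  rw [Real.sqrt_mul (by positivity), mul_comm 2, pow_mul, Real.sqrt_sq (by positivity)]

theorem abs_harm_sub_le (i k : Fin (N + 1)) (u : Fin (N + 1) → ℝ) :
    |harm i u k - u k| ≤ 2 * √(Q0 u) := by
  have h1 := abs_sub_le_sqrt_Q0 (harm i u) k i
  rw [harm_self] at h1
  have h2 := abs_sub_le_sqrt_Q0 u i k
  have h3 : √(Q0 (harm i u)) ≤ √(Q0 u) := by
    refine Real.sqrt_le_sqrt ((Q0_harm_le i u).trans (mul_le_of_le_one_left (Q0_nonneg u) ?_))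
    refine pow_le_one₀ (by positivity) ((div_le_one (by positivity)).2 (by linarith))
  have := abs_sub_le (harm i u k) (u i) (u k)
  linarith

theorem harm_le {i : Fin (N + 1)} {u : Fin (N + 1) → ℝ} {c : ℝ} (h : ∀ k, u k ≤ c)
    (k : Fin (N + 1)) : harm i u k ≤ c := by
  by_cases hk : k = i
  · rw [hk, harm_self]
    exact h i
  · have hs : ∑ l, u l ≤ ∑ _l : Fin (N + 1), c := Finset.sum_le_sum fun l _ => h l
    simp only [Finset.sum_const, Finset.card_univ, Fintype.card_fin, nsmul_eq_mul] at hs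
    push_cast at hs
    rw [harm_of_ne hk, div_le_iff₀ (by positivity)]
    linarith [h i, h k]

theorem harm_lt {i k : Fin (N + 1)} {u : Fin (N + 1) → ℝ} {c : ℝ} (h : ∀ k, u k ≤ c)
    (hk : u i < c ∨ u k < c) : harm i u k < c := by
  by_cases hki : k = i
  · rw [hki, harm_self]
    simpa [hki] using hk
  · have hs : ∑ l, u l ≤ ∑ _l : Fin (N + 1), c := Finset.sum_le_sum fun l _ => h l
    simp only [Finset.sum_const, Finset.card_univ, Fintype.card_fin, nsmul_eq_mul] at hs
    push_cast at hs
    rw [harm_of_ne hki, div_lt_iff₀ (by positivity)]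
    rcases hk with hk | hk <;> linarith [h i, h k]

end Algebra

/-! ### Symbolic coding of the gasket and the identifications it makes. -/

section Coding

section Sequences

variable {S : Type*}

/-- The sequence `i ω_1 ω_2 ⋯`. -/
def seqCons (i : S) (ω : ℕ → S) : ℕ → S
  | 0 => i
  | n + 1 => ω n

/-- The sequence `ω_2 ω_3 ⋯`. -/
def shift (ω : ℕ → S) : ℕ → S := fun n => ω (n + 1)

/-- The sequence `w ω` for a finite word `w`. -/
def prepend (w : List S) (ω : ℕ → S) : ℕ → S := w.foldr seqCons ω

@[simp] theorem seqCons_zero (i : S) (ω : ℕ → S) : seqCons i ω 0 = i := rfl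

@[simp] theorem shift_seqCons (i : S) (ω : ℕ → S) : shift (seqCons i ω) = ω := rfl

@[simp] theorem seqCons_shift (ω : ℕ → S) : seqCons (ω 0) (shift ω) = ω := by
  ext n
  cases n <;> rfl

@[simp] theorem prepend_nil (ω : ℕ → S) : prepend [] ω = ω := rfl

@[simp] theorem prepend_cons (i : S) (w : List S) (ω : ℕ → S) :
    prepend (i :: w) ω = seqCons i (prepend w ω) := rfl

theorem prepend_append (v w : List S) (ω : ℕ → S) :
    prepend (v ++ w) ω = prepend v (prepend w ω) := by
  simp [prepend]

end Sequences

variable {N : ℕ}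

theorem initialWord_zero (ω : ℕ → Fin (N + 1)) : initialWord ω 0 = [] := rfl

theorem initialWord_succ (ω : ℕ → Fin (N + 1)) (n : ℕ) :
    initialWord ω (n + 1) = ω 0 :: initialWord (shift ω) n := by
  simp [initialWord, List.ofFn_succ, shift]

theorem initialWord_succ' (ω : ℕ → Fin (N + 1)) (n : ℕ) :
    initialWord ω (n + 1) = initialWord ω n ++ [ω n] := by
  rw [initialWord, List.ofFn_succ', List.concat_eq_append]
  rfl

@[simp] theorem length_initialWord (ω : ℕ → Fin (N + 1)) (n : ℕ) :
    (initialWord ω n).length = n := by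
  simp [initialWord]

theorem prepend_initialWord (ω : ℕ → Fin (N + 1)) (n : ℕ) :
    prepend (initialWord ω n) (shift^[n] ω) = ω := by
  induction n generalizing ω with
  | zero => rfl
  | succ n ih =>
    rw [initialWord_succ, prepend_cons, Function.iterate_succ_apply, ih, seqCons_shift]

theorem initialWord_prepend (w : List (Fin (N + 1))) (ω : ℕ → Fin (N + 1)) :
    initialWord (prepend w ω) w.length = w := by
  induction w with
  | nil => rfl
  | cons i w ih => rw [List.length_cons, initialWord_succ, prepend_cons, shift_seqCons, ih]; rfl

theorem exists_initialWord_eq_of_ne {ω η : ℕ → Fin (N + 1)} (h : ω ≠ η) :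
    ∃ n, initialWord ω n = initialWord η n ∧ (shift^[n] ω) 0 ≠ (shift^[n] η) 0 := by
  classical
  have hne : ∃ n, ω n ≠ η n := by
    by_contra! hc
    exact h (funext hc)
  have hs : ∀ (n : ℕ) (ω : ℕ → Fin (N + 1)), (shift^[n] ω) 0 = ω n := by
    intro n
    induction n with
    | zero => exact fun _ => rfl
    | succ n ih => exact fun ω => by rw [Function.iterate_succ_apply, ih]; rfl
  refine ⟨Nat.find hne, ?_, ?_⟩
  · unfold initialWord
    congr 1
    ext k
    rw [not_not.1 (Nat.find_min hne k.2)]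
  · rw [hs, hs]
    exact Nat.find_spec hne

variable (p : Fin (N + 1) → EuclideanSpace ℝ (Fin N))

@[simp] theorem psiWord_nil (z : EuclideanSpace ℝ (Fin N)) : psiWord p [] z = z := rfl

@[simp] theorem psiWord_cons (i : Fin (N + 1)) (w : List (Fin (N + 1)))
    (z : EuclideanSpace ℝ (Fin N)) : psiWord p (i :: w) z = psi p i (psiWord p w z) := rfl

theorem psiWord_append (v w : List (Fin (N + 1))) (z : EuclideanSpace ℝ (Fin N)) :
    psiWord p (v ++ w) z = psiWord p v (psiWord p w z) := by
  simp [psiWord]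

theorem psi_sub_psi (i : Fin (N + 1)) (x y : EuclideanSpace ℝ (Fin N)) :
    psi p i x - psi p i y = (1 / 2 : ℝ) • (x - y) := by
  simp only [psi, smul_add, smul_sub]
  abel

theorem psi_self (i : Fin (N + 1)) : psi p i (p i) = p i := by
  simp only [psi, ← two_smul ℝ (p i), smul_smul]
  norm_num

theorem psi_symm (i j : Fin (N + 1)) : psi p i (p j) = psi p j (p i) := by
  simp only [psi, add_comm]

theorem dist_psiWord (w : List (Fin (N + 1))) (x y : EuclideanSpace ℝ (Fin N)) :
    dist (psiWord p w x) (psiWord p w y) = (1 / 2) ^ w.length * dist x y := by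
  induction w with
  | nil => simp
  | cons i w ih =>
    rw [psiWord_cons, psiWord_cons, dist_eq_norm, psi_sub_psi, norm_smul, ← dist_eq_norm, ih,
      List.length_cons, pow_succ]
    norm_num
    ring

theorem psiWord_injective (w : List (Fin (N + 1))) : Function.Injective (psiWord p w) := by
  intro x y h
  have := dist_psiWord p w x y
  rw [h, dist_self] at this
  have h2 : (0 : ℝ) < (1 / 2) ^ w.length := by positivity
  exact dist_eq_zero.1 ((mul_eq_zero.1 this.symm).resolve_left h2.ne')

theorem psi_injective (i : Fin (N + 1)) : Function.Injective (psi p i) :=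
  psiWord_injective p [i]

/-- The point `∑ 2^{-n-1} p_{ω_n}`, which is the common point of the cells `K_{[ω]_n}`. -/
noncomputable def code (ω : ℕ → Fin (N + 1)) : EuclideanSpace ℝ (Fin N) :=
  ∑' n, (1 / 2 : ℝ) ^ (n + 1) • p (ω n)

theorem exists_norm_le : ∃ C, ∀ i, ‖p i‖ ≤ C :=
  ⟨∑ i, ‖p i‖, fun i => Finset.single_le_sum (f := fun i => ‖p i‖) (fun _ _ => norm_nonneg _)
    (Finset.mem_univ i)⟩

theorem summable_half_pow_succ_mul (C : ℝ) : Summable fun n : ℕ => (1 / 2 : ℝ) ^ (n + 1) * C := by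
  have := (summable_nat_add_iff 1).2 (summable_geometric_two)
  exact this.mul_right C

theorem summable_code (ω : ℕ → Fin (N + 1)) :
    Summable fun n => (1 / 2 : ℝ) ^ (n + 1) • p (ω n) := by
  obtain ⟨C, hC⟩ := exists_norm_le p
  refine Summable.of_norm_bounded (summable_half_pow_succ_mul C) fun n => ?_
  rw [norm_smul, Real.norm_of_nonneg (by positivity)]
  exact mul_le_mul_of_nonneg_left (hC _) (by positivity)

theorem code_eq (ω : ℕ → Fin (N + 1)) : code p ω = psi p (ω 0) (code p (shift ω)) := by
  unfold code psi
  rw [(summable_code p ω).tsum_eq_zero_add, smul_add, ← tsum_const_smul'', add_comm]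
  congr 1
  · refine tsum_congr fun n => ?_
    rw [smul_smul, pow_succ' (1 / 2 : ℝ) (n + 1)]
    rfl
  · simp

theorem code_seqCons (i : Fin (N + 1)) (ω : ℕ → Fin (N + 1)) :
    code p (seqCons i ω) = psi p i (code p ω) := code_eq p _

theorem code_prepend (w : List (Fin (N + 1))) (ω : ℕ → Fin (N + 1)) :
    code p (prepend w ω) = psiWord p w (code p ω) := by
  induction w with
  | nil => rfl
  | cons i w ih => rw [prepend_cons, code_seqCons, ih]; rfl

theorem code_const (i : Fin (N + 1)) : code p (fun _ => i) = p i := by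
  have h := code_eq p fun _ => i
  have h2 : dist (code p fun _ => i) (p i) = 1 / 2 * dist (code p fun _ => i) (p i) := by
    conv_lhs => rw [h, ← psi_self p i]
    exact (dist_psiWord p [i] (code p fun _ => i) (p i)).trans (by simp)
  exact dist_eq_zero.1 (by linarith)

theorem continuous_code : Continuous (code p) := by
  obtain ⟨C, hC⟩ := exists_norm_le p
  refine continuous_tsum (fun n => ?_) (summable_half_pow_succ_mul C) fun n ω => ?_
  · have : Continuous p := continuous_of_discreteTopology
    fun_prop
  · rw [norm_smul, Real.norm_of_nonneg (by positivity)]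
    exact mul_le_mul_of_nonneg_left (hC _) (by positivity)

theorem tendsto_half_pow_mul (C : ℝ) :
    Tendsto (fun n : ℕ => (1 / 2 : ℝ) ^ n * C) atTop (𝓝 0) := by
  simpa using (tendsto_pow_atTop_nhds_zero_of_lt_one (r := (1 / 2 : ℝ)) (by norm_num)
    (by norm_num)).mul_const C

theorem tendsto_psiWord_initialWord (ω : ℕ → Fin (N + 1)) (z : EuclideanSpace ℝ (Fin N)) :
    Tendsto (fun n => psiWord p (initialWord ω n) z) atTop (𝓝 (code p ω)) := by
  have hb : Bornology.IsBounded ({z} ∪ Set.range (code p)) :=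
    Bornology.isBounded_singleton.union (isCompact_range (continuous_code p)).isBounded
  obtain ⟨D, hD⟩ := Metric.isBounded_iff.1 hb
  rw [tendsto_iff_dist_tendsto_zero]
  refine squeeze_zero (fun _ => dist_nonneg) (fun n => ?_) (tendsto_half_pow_mul D)
  conv_lhs => rw [← prepend_initialWord ω n, code_prepend, prepend_initialWord, dist_psiWord,
    length_initialWord]
  exact mul_le_mul_of_nonneg_left (hD (Or.inl rfl) (Or.inr ⟨_, rfl⟩)) (by positivity)

theorem code_mem_convexHull (ω : ℕ → Fin (N + 1)) :
    code p ω ∈ convexHull ℝ (Set.range p) := by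
  have hcl : IsClosed (convexHull ℝ (Set.range p)) :=
    ((Set.finite_range p).isCompact_convexHull ℝ).isClosed
  have hmem : ∀ w : List (Fin (N + 1)), psiWord p w (p 0) ∈ convexHull ℝ (Set.range p) := by
    intro w
    have := Set.mem_iInter.1 (psiWord_mem_gasket p w (vertex_mem_gasket p 0)) 0
    obtain ⟨v, y, hy, h⟩ := Set.mem_iUnion.1 this
    rw [← h]
    simpa using hy
  exact hcl.mem_of_tendsto (tendsto_psiWord_initialWord p ω (p 0))
    (Eventually.of_forall fun n => hmem _)

theorem code_mem_gasket (ω : ℕ → Fin (N + 1)) : code p ω ∈ gasket p := by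
  refine Set.mem_iInter.2 fun m => Set.mem_iUnion.2
    ⟨fun k => ω k, code p (shift^[m] ω), code_mem_convexHull p _, ?_⟩
  change psiWord p (initialWord ω m) _ = _
  rw [← code_prepend, prepend_initialWord]

/-- Choosing inverse branches repeatedly produces the letters of a code, and boundedness of `T`
makes the error at step `n` of order `2^(-n)`. Used for the gasket with all letters and for an edge
with the letters `i, j`. -/
theorem exists_code_eq_of_selfSimilar {T : Set (EuclideanSpace ℝ (Fin N))}
    (hT : Bornology.IsBounded T) (A : Set (Fin (N + 1)))
    (h : ∀ x ∈ T, ∃ i ∈ A, ∃ y ∈ T, x = psi p i y) {x : EuclideanSpace ℝ (Fin N)} (hx : x ∈ T) :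
    ∃ ω : ℕ → Fin (N + 1), (∀ n, ω n ∈ A) ∧ code p ω = x := by
  choose! d hd z hz hxz using h
  have hit : ∀ n, z^[n] x ∈ T := by
    intro n
    induction n with
    | zero => exact hx
    | succ n ih => rw [Function.iterate_succ_apply']; exact hz _ ih
  set ω : ℕ → Fin (N + 1) := fun n => d (z^[n] x) with hω
  have hpsi : ∀ n, psiWord p (initialWord ω n) (z^[n] x) = x := by
    intro n
    induction n with
    | zero => rfl
    | succ n ih =>
      rw [initialWord_succ', psiWord_append, Function.iterate_succ_apply']
      change psiWord p (initialWord ω n) (psi p (d (z^[n] x)) (z (z^[n] x))) = x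
      rw [← hxz _ (hit n), ih]
  refine ⟨ω, fun n => hd _ (hit n), ?_⟩
  have hb : Bornology.IsBounded (T ∪ Set.range (code p)) :=
    hT.union (isCompact_range (continuous_code p)).isBounded
  obtain ⟨D, hD⟩ := Metric.isBounded_iff.1 hb
  have hle : ∀ n : ℕ, dist (code p ω) x ≤ (1 / 2 : ℝ) ^ n * D := by
    intro n
    have h1 : code p ω = psiWord p (initialWord ω n) (code p (shift^[n] ω)) := by
      rw [← code_prepend, prepend_initialWord]
    have h2 := dist_psiWord p (initialWord ω n) (code p (shift^[n] ω)) (z^[n] x)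
    rw [← h1, hpsi n, length_initialWord] at h2
    rw [h2]
    exact mul_le_mul_of_nonneg_left (hD (Or.inr ⟨_, rfl⟩) (Or.inl (hit n))) (by positivity)
  exact dist_le_zero.1 (ge_of_tendsto' (tendsto_half_pow_mul D) hle)

theorem gasket_subset_convexHull : gasket p ⊆ convexHull ℝ (Set.range p) := by
  intro x hx
  obtain ⟨w, y, hy, h⟩ := Set.mem_iUnion.1 (Set.mem_iInter.1 hx 0)
  rw [← h]
  simpa using hy

theorem psi_mem_convexHull (i : Fin (N + 1)) {z : EuclideanSpace ℝ (Fin N)}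
    (hz : z ∈ convexHull ℝ (Set.range p)) : psi p i z ∈ convexHull ℝ (Set.range p) := by
  have := (convex_convexHull ℝ (Set.range p)) hz (subset_convexHull ℝ _ ⟨i, rfl⟩)
    (show (0 : ℝ) ≤ 1 / 2 by norm_num) (show (0 : ℝ) ≤ 1 / 2 by norm_num) (by norm_num)
  simpa only [psi, smul_add] using this

theorem exists_psi_eq_of_mem_gasket {x : EuclideanSpace ℝ (Fin N)} (hx : x ∈ gasket p) :
    ∃ i, ∃ y ∈ gasket p, x = psi p i y := by
  set T : ℕ → Set (EuclideanSpace ℝ (Fin N)) := fun m => ⋃ w : Fin m → Fin (N + 1),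
    psiWord p (List.ofFn w) '' convexHull ℝ (Set.range p) with hT
  have hanti : Antitone T := by
    refine antitone_nat_of_succ_le fun m y hy => ?_
    obtain ⟨w, z, hz, h⟩ := Set.mem_iUnion.1 hy
    rw [List.ofFn_succ', List.concat_eq_append, psiWord_append] at h
    exact Set.mem_iUnion.2 ⟨_, _, psi_mem_convexHull p _ hz, h⟩
  have hstep : ∀ m, ∃ i, ∃ y ∈ T m, x = psi p i y := by
    intro m
    obtain ⟨w, z, hz, h⟩ := Set.mem_iUnion.1 (Set.mem_iInter.1 hx (m + 1))
    rw [List.ofFn_succ, psiWord_cons] at h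
    exact ⟨_, _, Set.mem_iUnion.2 ⟨_, z, hz, rfl⟩, h.symm⟩
  by_contra! hc
  -- By injectivity of `psi p i` the preimage of `x` is the same point at every level, so a letter
  -- that never fails would put that point in the gasket.
  have hfail : ∀ i, ∃ m, ∀ y ∈ T m, x ≠ psi p i y := by
    intro i
    by_contra! hi
    obtain ⟨y, -, hxy⟩ := hi 0
    refine hc i y (Set.mem_iInter.2 fun m => ?_) hxy
    obtain ⟨z, hz, hxz⟩ := hi m
    rwa [psi_injective p i (hxy.symm.trans hxz)]
  choose m hm using hfail
  -- The sum is a level beyond all the failure levels; since `T` decreases, every letter fails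
  -- there.
  obtain ⟨i, y, hy, hxy⟩ := hstep (∑ i, m i)
  exact hm i y (hanti (Finset.single_le_sum (f := m) (fun _ _ => Nat.zero_le _)
    (Finset.mem_univ i)) hy) hxy

theorem exists_code_eq {x : EuclideanSpace ℝ (Fin N)} (hx : x ∈ gasket p) :
    ∃ ω, code p ω = x := by
  have hb : Bornology.IsBounded (gasket p) :=
    ((Set.finite_range p).isCompact_convexHull ℝ).isBounded.subset (gasket_subset_convexHull p)
  obtain ⟨ω, -, h⟩ := exists_code_eq_of_selfSimilar p hb Set.univ (fun x hx => by
    obtain ⟨i, y, hy, h⟩ := exists_psi_eq_of_mem_gasket p hx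
    exact ⟨i, Set.mem_univ i, y, hy, h⟩) hx
  exact ⟨ω, h⟩

theorem range_code : Set.range (code p) = gasket p :=
  Set.Subset.antisymm (Set.range_subset_iff.2 (code_mem_gasket p)) fun _ hx => exists_code_eq p hx

theorem isCompact_gasket : IsCompact (gasket p) :=
  range_code p ▸ isCompact_range (continuous_code p)

instance : CompactSpace (gasket p) := isCompact_iff_compactSpace.1 (isCompact_gasket p)

/-- The coding map onto the gasket. -/
noncomputable def codeK : C(ℕ → Fin (N + 1), gasket p) where
  toFun ω := ⟨code p ω, code_mem_gasket p ω⟩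
  continuous_toFun := (continuous_code p).subtype_mk _

theorem codeK_surjective : Function.Surjective (codeK p) := fun x => by
  obtain ⟨ω, h⟩ := exists_code_eq p x.2
  exact ⟨ω, Subtype.ext h⟩

/-- Allows continuous functions on the gasket to be defined on sequences, subject only to agreement
on different codes of a point. -/
theorem isQuotientMap_codeK : IsQuotientMap (codeK p) :=
  (codeK p).continuous.isClosedMap.isQuotientMap (codeK p).continuous (codeK_surjective p)

theorem codeK_prepend_const (w : List (Fin (N + 1))) (i : Fin (N + 1)) :
    codeK p (prepend w fun _ => i) = vertex p w i :=
  Subtype.ext ((code_prepend p w _).trans (congrArg (psiWord p w) (code_const p i)))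

theorem isCodedBy_code (w : List (Fin (N + 1))) (ω : ℕ → Fin (N + 1)) :
    IsCodedBy p w ω (psiWord p w (code p ω)) := by
  have hmem : ∀ n, psiWord p w (code p ω) ∈ cell p (w ++ initialWord ω n) := fun n =>
    ⟨code p (shift^[n] ω), code_mem_gasket p _, by
      rw [← code_prepend, prepend_append, prepend_initialWord, code_prepend]⟩
  refine Set.eq_singleton_iff_unique_mem.2 ⟨Set.mem_iInter.2 hmem, fun x hx => ?_⟩
  obtain ⟨D, hD⟩ := Metric.isBounded_iff.1 (isCompact_gasket p).isBounded
  have hle : ∀ n : ℕ, dist x (psiWord p w (code p ω)) ≤ (1 / 2 : ℝ) ^ w.length * ((1 / 2) ^ n * D) := by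
    intro n
    obtain ⟨y, hy, hxy⟩ := Set.mem_iInter.1 hx n
    obtain ⟨z, hz, hwz⟩ := hmem n
    rw [← hxy, ← hwz, dist_psiWord, List.length_append, length_initialWord, pow_add, mul_assoc]
    have := hD hy hz
    gcongr
  have hlim : Tendsto (fun n : ℕ => (1 / 2 : ℝ) ^ w.length * ((1 / 2 : ℝ) ^ n * D)) atTop (𝓝 0) := by
    simpa using (tendsto_half_pow_mul D).const_mul ((1 / 2 : ℝ) ^ w.length)
  exact dist_le_zero.1 (ge_of_tendsto' hlim hle)

theorem IsCodedBy.eq {w : List (Fin (N + 1))} {ω : ℕ → Fin (N + 1)}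
    {x : EuclideanSpace ℝ (Fin N)} (h : IsCodedBy p w ω x) : x = psiWord p w (code p ω) :=
  (Set.singleton_injective (h.symm.trans (isCodedBy_code p w ω)))

theorem exists_affineMap_coord (hp : AffineIndependent ℝ p) :
    ∃ b : Fin (N + 1) → (EuclideanSpace ℝ (Fin N) →ᵃ[ℝ] ℝ),
      (∀ i j, b i (p j) = if i = j then 1 else 0) ∧ ∀ z, ∑ i, b i z = 1 := by
  have htop : affineSpan ℝ (Set.range p) = ⊤ := by
    rw [hp.affineSpan_eq_top_iff_card_eq_finrank_add_one]
    simp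
  let b : AffineBasis (Fin (N + 1)) ℝ (EuclideanSpace ℝ (Fin N)) := ⟨p, hp, htop⟩
  exact ⟨b.coord, fun i j => b.coord_apply i j, fun z => b.sum_coord_apply_eq_one z⟩

theorem coord_psi {b : EuclideanSpace ℝ (Fin N) →ᵃ[ℝ] ℝ} (i : Fin (N + 1))
    (z : EuclideanSpace ℝ (Fin N)) : b (psi p i z) = (b z + b (p i)) / 2 := by
  have : psi p i z = AffineMap.lineMap z (p i) (1 / 2 : ℝ) := by
    rw [AffineMap.lineMap_apply_module, psi, smul_add]
    norm_num
  rw [this, AffineMap.apply_lineMap, AffineMap.lineMap_apply_module]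
  simp only [smul_eq_mul]
  ring

theorem coord_code_nonneg {b : Fin (N + 1) → (EuclideanSpace ℝ (Fin N) →ᵃ[ℝ] ℝ)}
    (hb : ∀ i j, b i (p j) = if i = j then 1 else 0) (i : Fin (N + 1)) (ω : ℕ → Fin (N + 1)) :
    0 ≤ b i (code p ω) := by
  have hsub : convexHull ℝ (Set.range p) ⊆ b i ⁻¹' Set.Ici 0 := by
    refine convexHull_min ?_ ((convex_Ici 0).affine_preimage (b i))
    rintro _ ⟨j, rfl⟩
    simp only [Set.mem_preimage, hb, Set.mem_Ici]
    split_ifs <;> norm_num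
  exact hsub (code_mem_convexHull p ω)

theorem coord_code_le_one {b : Fin (N + 1) → (EuclideanSpace ℝ (Fin N) →ᵃ[ℝ] ℝ)}
    (hb : ∀ i j, b i (p j) = if i = j then 1 else 0) (hs : ∀ z, ∑ i, b i z = 1)
    (i : Fin (N + 1)) (ω : ℕ → Fin (N + 1)) : b i (code p ω) ≤ 1 := by
  rw [← hs (code p ω)]
  exact Finset.single_le_sum (f := fun i => b i (code p ω))
    (fun k _ => coord_code_nonneg p hb k ω) (Finset.mem_univ i)

theorem eq_const_of_coord_code_eq_one {b : Fin (N + 1) → (EuclideanSpace ℝ (Fin N) →ᵃ[ℝ] ℝ)}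
    (hb : ∀ i j, b i (p j) = if i = j then 1 else 0) (hs : ∀ z, ∑ i, b i z = 1)
    {ω : ℕ → Fin (N + 1)} {k : Fin (N + 1)} (h : b k (code p ω) = 1) : ω = fun _ => k := by
  have hstep : ∀ ω : ℕ → Fin (N + 1), b k (code p ω) = 1 →
      ω 0 = k ∧ b k (code p (shift ω)) = 1 := by
    intro ω h
    have h1 := coord_code_le_one p hb hs k (shift ω)
    rw [code_eq, coord_psi, hb] at h
    by_cases hk : k = ω 0
    · rw [if_pos hk] at h
      exact ⟨hk.symm, by linarith⟩
    · rw [if_neg hk] at h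
      linarith
  have hall : ∀ n, ∀ ω : ℕ → Fin (N + 1), b k (code p ω) = 1 → ω n = k := by
    intro n
    induction n with
    | zero => exact fun ω h => (hstep ω h).1
    | succ n ih => exact fun ω h => ih (shift ω) (hstep ω h).2
  exact funext fun n => hall n ω h

/-- A common point of the cells `ω 0` and `η 0` has both of these barycentric coordinates at least
`1/2`, so both equal `1/2`. This forces each tail to code a vertex, and a vertex has only the
constant code. -/
theorem tails_of_code_eq (hp : AffineIndependent ℝ p) {ω η : ℕ → Fin (N + 1)}
    (h : code p ω = code p η) (h0 : ω 0 ≠ η 0) :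
    (shift ω = fun _ => η 0) ∧ shift η = fun _ => ω 0 := by
  obtain ⟨b, hb, hs⟩ := exists_affineMap_coord p hp
  have key : ∀ ω η : ℕ → Fin (N + 1), code p ω = code p η → ω 0 ≠ η 0 →
      b (η 0) (code p (shift ω)) = 1 := by
    intro ω η h h0
    have e1 := congrArg (b (η 0)) h
    have e2 := congrArg (b (ω 0)) h
    have hpair : b (ω 0) (code p ω) + b (η 0) (code p ω) ≤ 1 := by
      rw [← hs (code p ω), ← Finset.sum_pair (f := fun i => b i (code p ω)) h0]
      exact Finset.sum_le_sum_of_subset_of_nonneg (Finset.subset_univ _)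
        fun k _ _ => coord_code_nonneg p hb k ω
    have n1 := coord_code_nonneg p hb (η 0) (shift η)
    have n2 := coord_code_nonneg p hb (ω 0) (shift ω)
    have n3 := coord_code_le_one p hb hs (η 0) (shift ω)
    rw [code_eq p ω, code_eq p η, coord_psi, coord_psi] at e1 e2
    rw [code_eq p ω, coord_psi, coord_psi] at hpair
    simp only [hb, if_neg h0, if_neg (Ne.symm h0), if_true] at e1 e2 hpair
    linarith
  exact ⟨eq_const_of_coord_code_eq_one p hb hs (key ω η h h0),
    eq_const_of_coord_code_eq_one p hb hs (key η ω h.symm h0.symm)⟩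

/-- Two sequences coding the same point differ by exchanging `u i j j j ⋯` and `u j i i i ⋯`. -/
theorem exists_prepend_of_code_eq (hp : AffineIndependent ℝ p) {ω η : ℕ → Fin (N + 1)}
    (h : code p ω = code p η) (hne : ω ≠ η) :
    ∃ (u : List (Fin (N + 1))) (i j : Fin (N + 1)), ω = prepend (u ++ [i]) (fun _ => j) ∧
      η = prepend (u ++ [j]) (fun _ => i) := by
  obtain ⟨n, hn, h0⟩ := exists_initialWord_eq_of_ne hne
  have hω := prepend_initialWord ω n
  have hη := prepend_initialWord η n
  rw [← hn] at hη
  have hc : code p (shift^[n] ω) = code p (shift^[n] η) := by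
    apply psiWord_injective p (initialWord ω n)
    rw [← code_prepend, ← code_prepend, hω, hη, h]
  obtain ⟨t1, t2⟩ := tails_of_code_eq p hp hc h0
  refine ⟨initialWord ω n, (shift^[n] ω) 0, (shift^[n] η) 0, ?_, ?_⟩
  · rw [prepend_append, prepend_cons, prepend_nil, ← t1, seqCons_shift, hω]
  · rw [prepend_append, prepend_cons, prepend_nil, ← t2, seqCons_shift, hη]

end Coding

/-! ### Construction of harmonic functions; they separate points. -/

section HarmonicFunctions

variable {N : ℕ}

/-- The value at the point coded by `ω` of the harmonic function with values `u` on `V_0`. -/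
noncomputable def harmVal (u : Fin (N + 1) → ℝ) (ω : ℕ → Fin (N + 1)) : ℝ :=
  limUnder atTop fun n => restr (initialWord ω n) u 0

theorem contraction_ratio_lt_one : ((N : ℝ) + 1) / ((N : ℝ) + 3) < 1 :=
  (div_lt_one (by positivity)).2 (by linarith)

theorem tendsto_contraction_ratio_pow (C : ℝ) :
    Tendsto (fun n : ℕ => (((N : ℝ) + 1) / ((N : ℝ) + 3)) ^ n * C) atTop (𝓝 0) := by
  simpa using (tendsto_pow_atTop_nhds_zero_of_lt_one (by positivity)
    (contraction_ratio_lt_one (N := N))).mul_const C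

theorem dist_restr_succ_le (u : Fin (N + 1) → ℝ) (ω : ℕ → Fin (N + 1)) (n : ℕ) :
    dist (restr (initialWord ω n) u 0) (restr (initialWord ω (n + 1)) u 0)
      ≤ 2 * √(Q0 u) * (((N : ℝ) + 1) / ((N : ℝ) + 3)) ^ n := by
  rw [initialWord_succ', restr_append, dist_comm, Real.dist_eq]
  refine (abs_harm_sub_le (ω n) 0 _).trans ?_
  have := sqrt_Q0_restr_le (initialWord ω n) u
  rw [length_initialWord] at this
  linarith

theorem tendsto_harmVal_zero (u : Fin (N + 1) → ℝ) (ω : ℕ → Fin (N + 1)) :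
    Tendsto (fun n => restr (initialWord ω n) u 0) atTop (𝓝 (harmVal u ω)) :=
  (cauchySeq_of_le_geometric _ _ contraction_ratio_lt_one (dist_restr_succ_le u ω)).tendsto_limUnder

theorem tendsto_harmVal (u : Fin (N + 1) → ℝ) (ω : ℕ → Fin (N + 1)) (k : Fin (N + 1)) :
    Tendsto (fun n => restr (initialWord ω n) u k) atTop (𝓝 (harmVal u ω)) := by
  have h : Tendsto (fun n => restr (initialWord ω n) u k - restr (initialWord ω n) u 0) atTop
      (𝓝 0) := by
    refine squeeze_zero_norm (fun n => ?_) (tendsto_contraction_ratio_pow (N := N) √(Q0 u))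
    refine (abs_sub_le_sqrt_Q0 _ k 0).trans ?_
    simpa using sqrt_Q0_restr_le (initialWord ω n) u
  simpa using h.add (tendsto_harmVal_zero u ω)

theorem harmVal_eq (u : Fin (N + 1) → ℝ) (ω : ℕ → Fin (N + 1)) :
    harmVal u ω = harmVal (harm (ω 0) u) (shift ω) := by
  refine tendsto_nhds_unique ((tendsto_add_atTop_iff_nat 1).2 (tendsto_harmVal_zero u ω)) ?_
  simpa only [initialWord_succ, restr_cons] using tendsto_harmVal_zero (harm (ω 0) u) (shift ω)

theorem harmVal_prepend (w : List (Fin (N + 1))) (u : Fin (N + 1) → ℝ) (ω : ℕ → Fin (N + 1)) :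
    harmVal u (prepend w ω) = harmVal (restr w u) ω := by
  induction w generalizing u with
  | nil => rfl
  | cons i w ih => rw [harmVal_eq, prepend_cons, shift_seqCons, ih]; rfl

theorem harmVal_const (u : Fin (N + 1) → ℝ) (k : Fin (N + 1)) :
    harmVal u (fun _ => k) = u k := by
  have h : ∀ (n : ℕ) (u : Fin (N + 1) → ℝ), restr (initialWord (fun _ => k) n) u k = u k := by
    intro n
    induction n with
    | zero => exact fun u => rfl
    | succ n ih =>
      intro u
      rw [initialWord_succ, restr_cons]
      exact (ih _).trans (harm_self k u)
  refine tendsto_nhds_unique (tendsto_harmVal u _ k) ?_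
  simp only [h]
  exact tendsto_const_nhds

theorem continuous_harmVal (u : Fin (N + 1) → ℝ) : Continuous (harmVal u) := by
  have hu : TendstoUniformly (fun n ω => restr (initialWord ω n) u 0) (harmVal u) atTop := by
    rw [Metric.tendstoUniformly_iff]
    intro ε hε
    have hlim := tendsto_contraction_ratio_pow (N := N)
      (2 * √(Q0 u) / (1 - ((N : ℝ) + 1) / ((N : ℝ) + 3)))
    filter_upwards [hlim.eventually (gt_mem_nhds hε)] with n hn ω
    rw [dist_comm]
    refine lt_of_le_of_lt (dist_le_of_le_geometric_of_tendsto _ _ contraction_ratio_lt_one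
      (dist_restr_succ_le u ω) (tendsto_harmVal_zero u ω) n) (lt_of_eq_of_lt ?_ hn)
    ring
  refine hu.continuous (Frequently.of_forall fun n => ?_)
  have hc : Continuous fun v : Fin n → Fin (N + 1) => restr (List.ofFn v) u 0 :=
    continuous_of_discreteTopology
  exact hc.comp (by fun_prop : Continuous fun (ω : ℕ → Fin (N + 1)) (k : Fin n) => ω k)

theorem harmVal_le {u : Fin (N + 1) → ℝ} {c : ℝ} (h : ∀ k, u k ≤ c) (ω : ℕ → Fin (N + 1)) :
    harmVal u ω ≤ c := by
  have hw : ∀ (w : List (Fin (N + 1))) (u : Fin (N + 1) → ℝ), (∀ k, u k ≤ c) →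
      restr w u 0 ≤ c := by
    intro w
    induction w with
    | nil => exact fun u h => h 0
    | cons i w ih => exact fun u h => ih _ (harm_le h)
  exact le_of_tendsto' (tendsto_harmVal_zero u ω) fun n => hw _ u h

theorem harmVal_neg (u : Fin (N + 1) → ℝ) (ω : ℕ → Fin (N + 1)) :
    harmVal (-u) ω = -harmVal u ω := by
  refine tendsto_nhds_unique (tendsto_harmVal_zero (-u) ω) ?_
  simpa only [map_neg, Pi.neg_apply] using (tendsto_harmVal_zero u ω).neg

theorem le_harmVal {u : Fin (N + 1) → ℝ} {c : ℝ} (h : ∀ k, c ≤ u k) (ω : ℕ → Fin (N + 1)) :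
    c ≤ harmVal u ω := by
  have := harmVal_le (u := -u) (c := -c) (fun k => neg_le_neg (h k)) ω
  rw [harmVal_neg] at this
  linarith

/-- The strict maximum principle. -/
theorem eq_const_of_harmVal_eq {u : Fin (N + 1) → ℝ} {c : ℝ} {k₀ : Fin (N + 1)}
    (h : ∀ k, u k ≤ c) (hlt : ∀ k, k ≠ k₀ → u k < c) {ω : ℕ → Fin (N + 1)}
    (hω : harmVal u ω = c) : ω = fun _ => k₀ := by
  have hstep : ∀ (u : Fin (N + 1) → ℝ) (ω : ℕ → Fin (N + 1)), (∀ k, u k ≤ c) →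
      (∀ k, k ≠ k₀ → u k < c) → harmVal u ω = c → ω 0 = k₀ := by
    intro u ω h hlt hω
    by_contra h0
    -- Entering a cell away from `k₀` brings all vertex values strictly below `c`. By finiteness
    -- their maximum is also below `c`, and it bounds the limit value.
    have hl : ∀ k, harm (ω 0) u k < c := fun k => harm_lt h (Or.inl (hlt _ h0))
    obtain ⟨m, hm⟩ := Finite.exists_max (harm (ω 0) u)
    have := harmVal_le hm (shift ω)
    rw [← harmVal_eq, hω] at this
    exact absurd (hl m) (not_lt.2 this)
  have hall : ∀ (n : ℕ) (u : Fin (N + 1) → ℝ) (ω : ℕ → Fin (N + 1)), (∀ k, u k ≤ c) →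
      (∀ k, k ≠ k₀ → u k < c) → harmVal u ω = c → ω n = k₀ := by
    intro n
    induction n with
    | zero => exact hstep
    | succ n ih =>
      intro u ω h hlt hω
      have h0 := hstep u ω h hlt hω
      rw [harmVal_eq, h0] at hω
      exact ih _ (shift ω) (harm_le h) (fun k hk => harm_lt h (Or.inr (hlt k hk))) hω
  exact funext fun n => hall n u ω h hlt hω

/-- The level `2/(N+3)` separates the cell `i` from the others: `h_i` is at least this value on
`K_i` and, by `harm_single_of_ne`, at most this value on each other `K_j`, with equality there only
at the junction with `K_i`. -/
theorem harm_single_self (i : Fin (N + 1)) (k : Fin (N + 1)) :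
    2 / ((N : ℝ) + 3) ≤ harm i (Pi.single i 1) k := by
  by_cases hk : k = i
  · rw [hk, harm_self, Pi.single_eq_same, div_le_one (by positivity)]
    have : (0 : ℝ) ≤ N := by positivity
    linarith
  · rw [harm_of_ne hk, Finset.sum_pi_single', Pi.single_eq_same, Pi.single_eq_of_ne hk]
    simp
    norm_num

theorem harm_single_of_ne {i j : Fin (N + 1)} (hij : i ≠ j) (k : Fin (N + 1)) :
    harm j (Pi.single i 1) k ≤ 2 / ((N : ℝ) + 3) ∧
      (k ≠ i → harm j (Pi.single i 1) k < 2 / ((N : ℝ) + 3)) := by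
  by_cases hk : k = j
  · rw [hk, harm_self, Pi.single_eq_of_ne hij.symm]
    exact ⟨by positivity, fun _ => by positivity⟩
  · rw [harm_of_ne hk, Finset.sum_pi_single', Pi.single_eq_of_ne hij.symm, if_pos (Finset.mem_univ _)]
    constructor
    · by_cases hki : k = i
      · rw [hki, Pi.single_eq_same]
        norm_num
      · rw [Pi.single_eq_of_ne hki]
        gcongr
        norm_num
    · intro hki
      rw [Pi.single_eq_of_ne hki]
      gcongr
      norm_num

/-- If all harmonic functions agree at two points then their codes have matching tails. -/
theorem shift_eq_const_of_forall_harmVal_eq {ω η : ℕ → Fin (N + 1)} (h0 : ω 0 ≠ η 0)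
    (h : harmVal (Pi.single (ω 0) 1) ω = harmVal (Pi.single (ω 0) 1) η) :
    shift η = fun _ => ω 0 := by
  rw [harmVal_eq _ ω, harmVal_eq _ η] at h
  have h1 := le_harmVal (harm_single_self (ω 0)) (shift ω)
  have h2 := harmVal_le (fun k => (harm_single_of_ne h0 k).1) (shift η)
  exact eq_const_of_harmVal_eq (fun k => (harm_single_of_ne h0 k).1)
    (fun k => (harm_single_of_ne h0 k).2) (le_antisymm h2 (h ▸ h1))

variable (p : Fin (N + 1) → EuclideanSpace ℝ (Fin N))

theorem code_eq_of_forall_harmVal_eq {ω η : ℕ → Fin (N + 1)}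
    (h : ∀ u, harmVal u ω = harmVal u η) : code p ω = code p η := by
  by_contra hc
  obtain ⟨n, hn, h0⟩ := exists_initialWord_eq_of_ne fun e : ω = η => hc (e ▸ rfl)
  have hω := prepend_initialWord ω n
  have hη := prepend_initialWord η n
  rw [← hn] at hη
  -- The common prefix can be removed because `restr` is surjective. The remaining sequences begin
  -- with different letters, so the maximum principle identifies their tails.
  have h' : ∀ u, harmVal u (shift^[n] ω) = harmVal u (shift^[n] η) := by
    intro u
    obtain ⟨v, rfl⟩ := restr_surjective (initialWord ω n) u
    rw [← harmVal_prepend, ← harmVal_prepend, hω, hη, h]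
  have t1 := shift_eq_const_of_forall_harmVal_eq h0 (h' _)
  have t2 := shift_eq_const_of_forall_harmVal_eq h0.symm (h' _).symm
  apply hc
  rw [← hω, ← hη, code_prepend, code_prepend, code_eq p (shift^[n] ω), code_eq p (shift^[n] η),
    t1, t2, code_const, code_const, psi_symm]

/-- Distinct codes of one point are `v i j j j ⋯` and `v j i i i ⋯`; the two values agree by the
symmetry of `harm`. -/
theorem harmVal_eq_of_code_eq (hp : AffineIndependent ℝ p) (u : Fin (N + 1) → ℝ)
    {ω η : ℕ → Fin (N + 1)} (h : code p ω = code p η) : harmVal u ω = harmVal u η := by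
  by_cases hne : ω = η
  · rw [hne]
  obtain ⟨w, i, j, rfl, rfl⟩ := exists_prepend_of_code_eq p hp h hne
  rw [harmVal_prepend, harmVal_prepend, harmVal_const, harmVal_const, restr_append, restr_append]
  exact harm_symm i j _

/-- The harmonic function with values `u` on `V_0`. -/
noncomputable def harmFun (hp : AffineIndependent ℝ p) (u : Fin (N + 1) → ℝ) : C(gasket p, ℝ) :=
  (isQuotientMap_codeK p).lift ⟨harmVal u, continuous_harmVal u⟩
    fun _ _ h => harmVal_eq_of_code_eq p hp u (congrArg Subtype.val h)

theorem harmFun_codeK (hp : AffineIndependent ℝ p) (u : Fin (N + 1) → ℝ) (ω : ℕ → Fin (N + 1)) :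
    harmFun p hp u (codeK p ω) = harmVal u ω :=
  DFunLike.congr_fun ((isQuotientMap_codeK p).lift_comp ⟨harmVal u, continuous_harmVal u⟩
    fun _ _ h => harmVal_eq_of_code_eq p hp u (congrArg Subtype.val h)) ω

theorem harmFun_vertex (hp : AffineIndependent ℝ p) (u : Fin (N + 1) → ℝ)
    (w : List (Fin (N + 1))) (i : Fin (N + 1)) : harmFun p hp u (vertex p w i) = restr w u i := by
  rw [← codeK_prepend_const, harmFun_codeK, harmVal_prepend, harmVal_const]

end HarmonicFunctions

/-! ### The Dirichlet form and the identification of harmonic functions. -/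

section Energy

theorem sum_ofFn_succ {S M : Type*} [Fintype S] [AddCommMonoid M] (m : ℕ) (F : List S → M) :
    ∑ w : Fin (m + 1) → S, F (List.ofFn w) = ∑ w : Fin m → S, ∑ i, F (List.ofFn w ++ [i]) := by
  rw [← (Fin.snocEquiv fun _ : Fin (m + 1) => S).sum_comp, Fintype.sum_prod_type,
    Finset.sum_comm]
  refine Finset.sum_congr rfl fun w _ => Finset.sum_congr rfl fun i _ => ?_
  rw [List.ofFn_succ', List.concat_eq_append]
  simp [Fin.snocEquiv]

variable {N : ℕ} (p : Fin (N + 1) → EuclideanSpace ℝ (Fin N))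

theorem vertex_append_symm (w : List (Fin (N + 1))) (i k : Fin (N + 1)) :
    vertex p (w ++ [i]) k = vertex p (w ++ [k]) i :=
  Subtype.ext (by simp only [vertex, psiWord_append, psiWord_cons, psiWord_nil, psi_symm p i k])

theorem vertex_append_self (w : List (Fin (N + 1))) (i : Fin (N + 1)) :
    vertex p (w ++ [i]) i = vertex p w i :=
  Subtype.ext (by simp only [vertex, psiWord_append, psiWord_cons, psiWord_nil, psi_self])

/-- The values of `f` on `ψ_w(V_0)`. -/
noncomputable def cellVal (f : C(gasket p, ℝ)) (w : List (Fin (N + 1))) : Fin (N + 1) → ℝ :=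
  fun k => f (vertex p w k)

theorem Q_eq (m : ℕ) (f : C(gasket p, ℝ)) :
    Q p m f = ∑ w : Fin m → Fin (N + 1), Q0 (cellVal p f (List.ofFn w)) := rfl

theorem sum_Q0_cellVal_append (f : C(gasket p, ℝ)) (w : List (Fin (N + 1))) :
    ((N : ℝ) + 1) / ((N : ℝ) + 3) * Q0 (cellVal p f w)
      ≤ ∑ i, Q0 (cellVal p f (w ++ [i])) := by
  rw [sum_Q0_eq_add (fun i => cellVal p f (w ++ [i])) fun i k => by
    simp only [cellVal, vertex_append_symm]]
  have h : (fun k => cellVal p f (w ++ [k]) k) = cellVal p f w := by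
    ext k
    simp only [cellVal, vertex_append_self]
  rw [h]
  exact le_add_of_nonneg_right (Finset.sum_nonneg fun _ _ => Q0_nonneg _)

theorem cellVal_append_eq_harm {f : C(gasket p, ℝ)} {w : List (Fin (N + 1))}
    (h : ∑ i, Q0 (cellVal p f (w ++ [i])) ≤ ((N : ℝ) + 1) / ((N : ℝ) + 3) * Q0 (cellVal p f w))
    (i : Fin (N + 1)) : cellVal p f (w ++ [i]) = harm i (cellVal p f w) := by
  have h1 : (fun k => cellVal p f (w ++ [k]) k) = cellVal p f w := by
    ext k
    simp only [cellVal, vertex_append_self]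
  have := eq_harm_of_sum_Q0_le (fun i => cellVal p f (w ++ [i])) (fun i k => by
    simp only [cellVal, vertex_append_symm]) (by rwa [h1]) i
  rwa [h1] at this

theorem Q_succ_ge (m : ℕ) (f : C(gasket p, ℝ)) :
    ((N : ℝ) + 1) / ((N : ℝ) + 3) * Q p m f ≤ Q p (m + 1) f := by
  rw [Q_eq, Q_eq, sum_ofFn_succ m fun v => Q0 (cellVal p f v), Finset.mul_sum]
  exact Finset.sum_le_sum fun w _ => sum_Q0_cellVal_append p f _

theorem Q_nonneg (m : ℕ) (f : C(gasket p, ℝ)) : 0 ≤ Q p m f :=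
  Finset.sum_nonneg fun _ _ => Q0_nonneg _

/-- The renormalized energy of level `m`. -/
noncomputable def levelEnergy (m : ℕ) (f : C(gasket p, ℝ)) : ℝ :=
  (((N : ℝ) + 3) / ((N : ℝ) + 1)) ^ m * Q p m f

theorem levelEnergy_nonneg (m : ℕ) (f : C(gasket p, ℝ)) : 0 ≤ levelEnergy p m f :=
  mul_nonneg (by positivity) (Q_nonneg p m f)

theorem ratio_mul_inv_ratio : ((N : ℝ) + 3) / ((N : ℝ) + 1) * (((N : ℝ) + 1) / ((N : ℝ) + 3)) = 1 := by
  field_simp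

theorem levelEnergy_mono (f : C(gasket p, ℝ)) : Monotone fun m => levelEnergy p m f := by
  refine monotone_nat_of_le_succ fun m => ?_
  have h := mul_le_mul_of_nonneg_left (Q_succ_ge p m f)
    (show 0 ≤ ((N : ℝ) + 3) / ((N : ℝ) + 1) by positivity)
  rw [← mul_assoc, ratio_mul_inv_ratio, one_mul] at h
  simp only [levelEnergy]
  rw [pow_succ, mul_assoc]
  exact mul_le_mul_of_nonneg_left h (by positivity)

theorem levelEnergy_zero (f : C(gasket p, ℝ)) : levelEnergy p 0 f = Q0 (cellVal p f []) := by
  simp [levelEnergy, Q_eq]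

theorem mem_domain_of_le {f : C(gasket p, ℝ)} {C : ℝ} (h : ∀ m, levelEnergy p m f ≤ C) :
    f ∈ domain p :=
  (iSup_le fun m => ENNReal.ofReal_le_ofReal (h m)).trans_lt ENNReal.ofReal_lt_top

theorem levelEnergy_le {f : C(gasket p, ℝ)} (hf : f ∈ domain p) (m : ℕ) :
    levelEnergy p m f ≤ (energy p f).toReal :=
  (ENNReal.ofReal_le_iff_le_toReal (ne_of_lt hf)).1
    (le_iSup (fun m => ENNReal.ofReal (levelEnergy p m f)) m)

theorem toReal_energy_le {f : C(gasket p, ℝ)} {C : ℝ} (h : ∀ m, levelEnergy p m f ≤ C) :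
    (energy p f).toReal ≤ C := by
  refine ENNReal.toReal_le_of_le_ofReal ((levelEnergy_nonneg p 0 f).trans (h 0)) ?_
  exact iSup_le fun m => ENNReal.ofReal_le_ofReal (h m)

theorem tendsto_levelEnergy {f : C(gasket p, ℝ)} (hf : f ∈ domain p) :
    Tendsto (fun m => levelEnergy p m f) atTop (𝓝 (energy p f).toReal) := by
  have hb : BddAbove (Set.range fun m => levelEnergy p m f) :=
    ⟨_, Set.forall_mem_range.2 (levelEnergy_le p hf)⟩
  have h := tendsto_atTop_ciSup (levelEnergy_mono p f) hb
  have : ⨆ m, levelEnergy p m f = (energy p f).toReal :=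
    le_antisymm (ciSup_le (levelEnergy_le p hf)) (toReal_energy_le p fun m => le_ciSup hb m)
  rwa [this] at h

theorem add_mem_domain {f g : C(gasket p, ℝ)} (hf : f ∈ domain p) (hg : g ∈ domain p) :
    f + g ∈ domain p := by
  refine mem_domain_of_le p (C := 2 * (energy p f).toReal + 2 * (energy p g).toReal) fun m => ?_
  have hQ : Q p m (f + g) ≤ 2 * Q p m f + 2 * Q p m g := by
    simp only [Q_eq, Finset.mul_sum, ← Finset.sum_add_distrib]
    exact Finset.sum_le_sum fun w _ => Q0_add_le _ _
  have h := mul_le_mul_of_nonneg_left hQ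
    (show 0 ≤ (((N : ℝ) + 3) / ((N : ℝ) + 1)) ^ m by positivity)
  have h1 := levelEnergy_le p hf m
  have h2 := levelEnergy_le p hg m
  simp only [levelEnergy] at h1 h2 ⊢
  linarith

/-- Discrete Leibniz rule. It makes the domain an algebra, as Stone–Weierstrass requires. -/
theorem Q0_mul_le (u v : Fin (N + 1) → ℝ) {a b : ℝ} (hu : ∀ k, |u k| ≤ a) (hv : ∀ k, |v k| ≤ b) :
    Q0 (u * v) ≤ 2 * a ^ 2 * Q0 v + 2 * b ^ 2 * Q0 u := by
  have h : ∀ i j, (u i * v i - u j * v j) ^ 2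
      ≤ 2 * a ^ 2 * (v i - v j) ^ 2 + 2 * b ^ 2 * (u i - u j) ^ 2 := by
    intro i j
    have h1 : u i ^ 2 ≤ a ^ 2 := sq_le_sq' (abs_le.1 (hu i)).1 (abs_le.1 (hu i)).2
    have h2 : v j ^ 2 ≤ b ^ 2 := sq_le_sq' (abs_le.1 (hv j)).1 (abs_le.1 (hv j)).2
    have h3 := mul_le_mul_of_nonneg_right h1 (sq_nonneg (v i - v j))
    have h4 := mul_le_mul_of_nonneg_right h2 (sq_nonneg (u i - u j))
    nlinarith [sq_nonneg (u i * (v i - v j) - v j * (u i - u j))]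
  have := Finset.sum_le_sum fun i (_ : i ∈ Finset.univ) =>
    Finset.sum_le_sum fun j (_ : j ∈ Finset.univ) => h i j
  simp only [Finset.sum_add_distrib, ← Finset.mul_sum] at this
  simp only [Q0, Pi.mul_apply]
  linarith

theorem mul_mem_domain {f g : C(gasket p, ℝ)} (hf : f ∈ domain p) (hg : g ∈ domain p) :
    f * g ∈ domain p := by
  refine mem_domain_of_le p
    (C := 2 * ‖f‖ ^ 2 * (energy p g).toReal + 2 * ‖g‖ ^ 2 * (energy p f).toReal) fun m => ?_
  have hQ : Q p m (f * g) ≤ 2 * ‖f‖ ^ 2 * Q p m g + 2 * ‖g‖ ^ 2 * Q p m f := by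
    simp only [Q_eq, Finset.mul_sum, ← Finset.sum_add_distrib]
    exact Finset.sum_le_sum fun w _ => Q0_mul_le _ _ (fun k => f.norm_coe_le_norm _)
      fun k => g.norm_coe_le_norm _
  have h := mul_le_mul_of_nonneg_left hQ
    (show 0 ≤ (((N : ℝ) + 3) / ((N : ℝ) + 1)) ^ m by positivity)
  have h1 := mul_le_mul_of_nonneg_left (levelEnergy_le p hf m)
    (show 0 ≤ 2 * ‖g‖ ^ 2 by positivity)
  have h2 := mul_le_mul_of_nonneg_left (levelEnergy_le p hg m)
    (show 0 ≤ 2 * ‖f‖ ^ 2 by positivity)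
  simp only [levelEnergy] at h1 h2 ⊢
  linarith

theorem const_mem_domain (c : ℝ) : ContinuousMap.const (gasket p) c ∈ domain p := by
  refine mem_domain_of_le p (C := 0) fun m => le_of_eq ?_
  simp [levelEnergy, Q, Q0]

/-- The domain of the Dirichlet form as an algebra. -/
def domainSubalgebra : Subalgebra ℝ C(gasket p, ℝ) where
  carrier := domain p
  mul_mem' := mul_mem_domain p
  add_mem' := add_mem_domain p
  algebraMap_mem' c := const_mem_domain p c

/-- The polarization of the renormalized energy of level `m`. -/
noncomputable def levelForm (m : ℕ) (f g : C(gasket p, ℝ)) : ℝ :=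
  (1 / 2) * (levelEnergy p m (f + g) - levelEnergy p m f - levelEnergy p m g)

theorem tendsto_levelForm {f g : C(gasket p, ℝ)} (hf : f ∈ domain p) (hg : g ∈ domain p) :
    Tendsto (fun m => levelForm p m f g) atTop (𝓝 (form p f g)) :=
  (((tendsto_levelEnergy p (add_mem_domain p hf hg)).sub (tendsto_levelEnergy p hf)).sub
    (tendsto_levelEnergy p hg)).const_mul _

theorem levelForm_self (m : ℕ) (f : C(gasket p, ℝ)) : levelForm p m f f = levelEnergy p m f := by
  have h : Q p m (f + f) = 4 * Q p m f := by
    simp only [Q_eq, Finset.mul_sum]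
    refine Finset.sum_congr rfl fun w _ => ?_
    have : cellVal p (f + f) (List.ofFn w) = (2 : ℝ) • cellVal p f (List.ofFn w) :=
      (two_smul ℝ (cellVal p f (List.ofFn w))).symm
    rw [this, Q0_smul]
    norm_num
  rw [levelForm, levelEnergy, levelEnergy, h]
  ring

theorem form_self {f : C(gasket p, ℝ)} (hf : f ∈ domain p) :
    form p f f = (energy p f).toReal := by
  refine tendsto_nhds_unique (tendsto_levelForm p hf hf) ?_
  simpa only [levelForm_self] using tendsto_levelEnergy p hf

/-- At a finite level the functional defining the energy measure is integration of `g` against a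
positive discrete measure: the squared increment of `f` over each pair of vertices is placed on both
of them. -/
theorem two_mul_levelForm_sub (m : ℕ) (f g : C(gasket p, ℝ)) :
    2 * levelForm p m f (f * g) - levelForm p m (f ^ 2) g =
      (((N : ℝ) + 3) / ((N : ℝ) + 1)) ^ m * ∑ w : Fin m → Fin (N + 1), (1 / 2) * ∑ i, ∑ j,
        (f (vertex p (List.ofFn w) i) - f (vertex p (List.ofFn w) j)) ^ 2 *
          (g (vertex p (List.ofFn w) i) + g (vertex p (List.ofFn w) j)) := by
  have h : ∀ u v : Fin (N + 1) → ℝ,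
      (Q0 (u + u * v) - Q0 u - Q0 (u * v)) - (1 / 2) * (Q0 (u ^ 2 + v) - Q0 (u ^ 2) - Q0 v)
        = (1 / 2) * ∑ i, ∑ j, (u i - u j) ^ 2 * (v i + v j) := by
    intro u v
    simp only [Q0, ← mul_sub, ← Finset.sum_sub_distrib]
    congr 1
    rw [Finset.mul_sum, ← Finset.sum_sub_distrib]
    refine Finset.sum_congr rfl fun i _ => ?_
    rw [Finset.mul_sum, ← Finset.sum_sub_distrib]
    refine Finset.sum_congr rfl fun j _ => ?_
    simp only [Pi.add_apply, Pi.mul_apply, Pi.pow_apply]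
    ring
  have hs := Finset.sum_congr rfl fun (w : Fin m → Fin (N + 1)) (_ : w ∈ Finset.univ) =>
    h (cellVal p f (List.ofFn w)) (cellVal p g (List.ofFn w))
  refine Eq.trans ?_ (congrArg ((((N : ℝ) + 3) / ((N : ℝ) + 1)) ^ m * ·) hs)
  simp only [levelForm, levelEnergy, Q_eq, Finset.sum_sub_distrib, ← Finset.mul_sum]
  have e1 : ∀ w, cellVal p (f + f * g) w = cellVal p f w + cellVal p f w * cellVal p g w :=
    fun _ => rfl
  have e2 : ∀ w, cellVal p (f * g) w = cellVal p f w * cellVal p g w := fun _ => rfl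
  have e3 : ∀ w, cellVal p (f ^ 2 + g) w = cellVal p f w ^ 2 + cellVal p g w := fun _ => rfl
  have e4 : ∀ w, cellVal p (f ^ 2) w = cellVal p f w ^ 2 := fun _ => rfl
  simp only [e1, e2, e3, e4]
  ring

section Harmonic

variable (hp : AffineIndependent ℝ p)
include hp

theorem cellVal_harmFun (u : Fin (N + 1) → ℝ) (w : List (Fin (N + 1))) :
    cellVal p (harmFun p hp u) w = restr w u := by
  ext k
  exact harmFun_vertex p hp u w k

theorem levelEnergy_harmFun (u : Fin (N + 1) → ℝ) (m : ℕ) :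
    levelEnergy p m (harmFun p hp u) = Q0 u := by
  induction m with
  | zero => rw [levelEnergy_zero, cellVal_harmFun]; rfl
  | succ m ih =>
    rw [← ih, levelEnergy, levelEnergy, Q_eq, Q_eq,
      sum_ofFn_succ m fun v => Q0 (cellVal p (harmFun p hp u) v)]
    simp only [cellVal_harmFun, restr_append, restr_cons, restr_nil, sum_Q0_harm, ← Finset.mul_sum]
    rw [pow_succ, mul_assoc, ← mul_assoc (((N : ℝ) + 3) / _), ratio_mul_inv_ratio, one_mul]

theorem harmFun_mem_domain (u : Fin (N + 1) → ℝ) : harmFun p hp u ∈ domain p :=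
  mem_domain_of_le p fun m => (levelEnergy_harmFun p hp u m).le

theorem toReal_energy_harmFun (u : Fin (N + 1) → ℝ) :
    (energy p (harmFun p hp u)).toReal = Q0 u :=
  tendsto_nhds_unique (tendsto_levelEnergy p (harmFun_mem_domain p hp u))
    (by simp only [levelEnergy_harmFun]; exact tendsto_const_nhds)

theorem isHarmonic_harmFun (u : Fin (N + 1) → ℝ) : IsHarmonic p (harmFun p hp u) := by
  refine ⟨harmFun_mem_domain p hp u, fun f hf hfu => ?_⟩
  rw [form_self p hf, form_self p (harmFun_mem_domain p hp u), toReal_energy_harmFun]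
  have h := levelEnergy_le p hf 0
  rw [levelEnergy_zero] at h
  have : cellVal p f [] = u := by
    ext k
    exact (hfu k).trans (harmFun_vertex p hp u [] k)
  rwa [this] at h

theorem IsHarmonic.eq_harmFun {h : C(gasket p, ℝ)} (hh : IsHarmonic p h) :
    h = harmFun p hp (cellVal p h []) := by
  set u := cellVal p h [] with hu
  have hE : (energy p h).toReal ≤ Q0 u := by
    have := hh.2 _ (harmFun_mem_domain p hp u) fun i => harmFun_vertex p hp u [] i
    rwa [form_self p hh.1, form_self p (harmFun_mem_domain p hp u),
      toReal_energy_harmFun] at this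
  -- Minimality pins the monotone sequence of level energies to its initial value. Equality then
  -- holds in the subdivision inequality of every single cell, which forces harmonic values there.
  have hconst : ∀ m, levelEnergy p m h = Q0 u := fun m =>
    le_antisymm ((levelEnergy_le p hh.1 m).trans hE)
      ((levelEnergy_zero p h).symm.le.trans (levelEnergy_mono p h (Nat.zero_le m)))
  have hQ : ∀ m, Q p (m + 1) h = ((N : ℝ) + 1) / ((N : ℝ) + 3) * Q p m h := by
    intro m
    have e := (hconst (m + 1)).trans (hconst m).symm
    simp only [levelEnergy] at e
    rw [pow_succ, mul_assoc] at e
    have e' := mul_left_cancel₀ (by positivity) e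
    rw [← e', ← mul_assoc, mul_comm (((N : ℝ) + 1) / _), ratio_mul_inv_ratio, one_mul]
  have hcell : ∀ (m : ℕ) (w : Fin m → Fin (N + 1)) (i : Fin (N + 1)),
      cellVal p h (List.ofFn w ++ [i]) = harm i (cellVal p h (List.ofFn w)) := by
    intro m w
    apply cellVal_append_eq_harm
    have e := hQ m
    rw [Q_eq, Q_eq, sum_ofFn_succ m fun v => Q0 (cellVal p h v), Finset.mul_sum, eq_comm,
      Finset.sum_eq_sum_iff_of_le fun w _ => sum_Q0_cellVal_append p h _] at e
    exact (e w (Finset.mem_univ w)).ge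
  have hrestr : ∀ w, cellVal p h w = restr w u := by
    intro w
    induction w using List.reverseRecOn with
    | nil => rfl
    | append_singleton w i ih =>
      have := hcell w.length w.get i
      rw [List.ofFn_get] at this
      rw [this, ih, restr_append]
      rfl
  ext x
  obtain ⟨ω, rfl⟩ := codeK_surjective p x
  rw [harmFun_codeK]
  refine tendsto_nhds_unique ?_ (tendsto_harmVal_zero u ω)
  have hv : Tendsto (fun n => vertex p (initialWord ω n) 0) atTop (𝓝 (codeK p ω)) :=
    tendsto_subtype_rng.2 (tendsto_psiWord_initialWord p ω (p 0))
  simp only [← hrestr]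
  exact (h.continuous.tendsto _).comp hv

theorem harmonicExt_eq (u : Fin (N + 1) → ℝ) : harmonicExt p u = harmFun p hp u := by
  have h := Classical.epsilon_spec (p := fun h => IsHarmonic p h ∧ ∀ i, h (vertex p [] i) = u i)
    ⟨harmFun p hp u, isHarmonic_harmFun p hp u, fun i => harmFun_vertex p hp u [] i⟩
  have h1 := h.1.eq_harmFun p hp
  have h2 : cellVal p (Classical.epsilon fun h => IsHarmonic p h ∧ ∀ i, h (vertex p [] i) = u i) []
      = u := funext h.2
  rw [h2] at h1
  exact h1

theorem separatesPoints_domainSubalgebra : (domainSubalgebra p).SeparatesPoints := by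
  intro x y hxy
  obtain ⟨ω, rfl⟩ := codeK_surjective p x
  obtain ⟨η, rfl⟩ := codeK_surjective p y
  by_contra! hc
  refine hxy (Subtype.ext (code_eq_of_forall_harmVal_eq p fun u => ?_))
  rw [← harmFun_codeK p hp, ← harmFun_codeK p hp]
  exact hc _ ⟨_, harmFun_mem_domain p hp u, rfl⟩

end Harmonic

end Energy

/-! ### Energy measures, and their values on cells. -/

section EnergyMeasures

open MeasureTheory

variable {N : ℕ}

/-- The cylinder of all sequences that start with `v`. -/
def cylinder (v : List (Fin (N + 1))) : Set (ℕ → Fin (N + 1)) :=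
  {ω | initialWord ω v.length = v}

theorem isClopen_cylinder (v : List (Fin (N + 1))) : IsClopen (cylinder v) := by
  have hc : Continuous fun (ω : ℕ → Fin (N + 1)) (k : Fin v.length) => ω k := by fun_prop
  exact (isClopen_discrete {a : Fin v.length → Fin (N + 1) | List.ofFn a = v}).preimage hc

theorem initialWord_prepend_of_le (w : List (Fin (N + 1))) (ω : ℕ → Fin (N + 1)) {n : ℕ}
    (h : n ≤ w.length) : initialWord (prepend w ω) n = w.take n := by
  induction w generalizing n with
  | nil => simp at h; subst h; rfl
  | cons i w ih =>
    cases n with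
    | zero => rfl
    | succ n =>
      rw [initialWord_succ, prepend_cons, shift_seqCons, ih (by simpa using h)]
      rfl

theorem mem_cylinder_iff {v : List (Fin (N + 1))} {ω : ℕ → Fin (N + 1)} :
    ω ∈ cylinder v ↔ ∃ η, ω = prepend v η := by
  constructor
  · intro h
    refine ⟨shift^[v.length] ω, ?_⟩
    have := prepend_initialWord ω v.length
    rw [show initialWord ω v.length = v from h] at this
    exact this.symm
  · rintro ⟨η, rfl⟩
    exact initialWord_prepend v η

/-- The energy of level `m` of the harmonic function with values `u` on `V_0`, distributed over the
sequences `w k k k ⋯` with `|w| = m`. -/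
noncomputable def levelMeasure (u : Fin (N + 1) → ℝ) (m : ℕ) : Measure (ℕ → Fin (N + 1)) :=
  ∑ w : Fin m → Fin (N + 1), ∑ i, ∑ j,
    ENNReal.ofReal ((((N : ℝ) + 3) / ((N : ℝ) + 1)) ^ m * ((1 / 2) *
      (restr (List.ofFn w) u i - restr (List.ofFn w) u j) ^ 2)) •
    (Measure.dirac (prepend (List.ofFn w) fun _ => i) +
      Measure.dirac (prepend (List.ofFn w) fun _ => j))

instance (u : Fin (N + 1) → ℝ) (m : ℕ) : IsFiniteMeasure (levelMeasure u m) := by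
  unfold levelMeasure
  have : ∀ (c : ℝ) (ω η : ℕ → Fin (N + 1)), IsFiniteMeasure
      (ENNReal.ofReal c • (Measure.dirac ω + Measure.dirac η)) := fun c ω η =>
    Measure.smul_finite _ ENNReal.ofReal_ne_top
  infer_instance

theorem integral_levelMeasure (u : Fin (N + 1) → ℝ) (m : ℕ) (g : C(ℕ → Fin (N + 1), ℝ)) :
    ∫ ω, g ω ∂levelMeasure u m =
      (((N : ℝ) + 3) / ((N : ℝ) + 1)) ^ m * ∑ w : Fin m → Fin (N + 1), (1 / 2) * ∑ i, ∑ j,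
        (restr (List.ofFn w) u i - restr (List.ofFn w) u j) ^ 2 *
          (g (prepend (List.ofFn w) fun _ => i) + g (prepend (List.ofFn w) fun _ => j)) := by
  have hint : ∀ (μ : Measure (ℕ → Fin (N + 1))) [IsFiniteMeasure μ], Integrable g μ := fun μ _ =>
    g.continuous.integrable_of_hasCompactSupport (HasCompactSupport.of_compactSpace _)
  have hfin : ∀ (c : ℝ) (ω η : ℕ → Fin (N + 1)), IsFiniteMeasure
      (ENNReal.ofReal c • (Measure.dirac ω + Measure.dirac η)) := fun c ω η =>
    Measure.smul_finite _ ENNReal.ofReal_ne_top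
  unfold levelMeasure
  rw [integral_finsetSum_measure fun w _ => hint _, Finset.mul_sum]
  refine Finset.sum_congr rfl fun w _ => ?_
  rw [integral_finsetSum_measure fun w _ => hint _, Finset.mul_sum, Finset.mul_sum]
  refine Finset.sum_congr rfl fun i _ => ?_
  rw [integral_finsetSum_measure fun w _ => hint _, Finset.mul_sum, Finset.mul_sum]
  refine Finset.sum_congr rfl fun j _ => ?_
  rw [integral_smul_measure, integral_add_measure (hint _) (hint _), integral_dirac,
    integral_dirac, ENNReal.toReal_ofReal (by positivity), smul_eq_mul]
  ring

/-- The energy carried by a cylinder does not depend on the level of the approximation. -/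
theorem sum_Q0_restr_take (u : Fin (N + 1) → ℝ) (v : List (Fin (N + 1))) {m : ℕ}
    (hm : v.length ≤ m) :
    (((N : ℝ) + 3) / ((N : ℝ) + 1)) ^ m * ∑ w : Fin m → Fin (N + 1),
      (if (List.ofFn w).take v.length = v then Q0 (restr (List.ofFn w) u) else 0)
      = (((N : ℝ) + 3) / ((N : ℝ) + 1)) ^ v.length * Q0 (restr v u) := by
  induction m, hm using Nat.le_induction with
  | base =>
    congr 1
    have h : ∀ w : Fin v.length → Fin (N + 1), (List.ofFn w).take v.length = v ↔ w = v.get := by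
      intro w
      rw [List.take_of_length_le (by simp)]
      constructor
      · intro h
        exact List.ofFn_injective (h.trans (List.ofFn_get v).symm)
      · rintro rfl
        exact List.ofFn_get v
    simp only [h, Finset.sum_ite_eq', Finset.mem_univ, if_true, List.ofFn_get]
  | succ m hm ih =>
    rw [← ih, sum_ofFn_succ m fun w => if w.take v.length = v then Q0 (restr w u) else 0, pow_succ,
      mul_assoc, Finset.mul_sum]
    congr 1
    refine Finset.sum_congr rfl fun w _ => ?_
    have ht : ∀ i, (List.ofFn w ++ [i]).take v.length = (List.ofFn w).take v.length := fun i =>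
      List.take_append_of_le_length (by simpa using hm)
    simp only [ht]
    split_ifs
    · simp only [restr_append, restr_cons, restr_nil, sum_Q0_harm]
      rw [← mul_assoc, ratio_mul_inv_ratio, one_mul]
    · simp

theorem integral_levelMeasure_cylinder (u : Fin (N + 1) → ℝ) (v : List (Fin (N + 1)))
    {g : C(ℕ → Fin (N + 1), ℝ)} (hg : ∀ ω, g ω = (cylinder v).indicator 1 ω) {m : ℕ}
    (hm : v.length ≤ m) :
    ∫ ω, g ω ∂levelMeasure u m
      = 2 * ((((N : ℝ) + 3) / ((N : ℝ) + 1)) ^ v.length * Q0 (restr v u)) := by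
  rw [integral_levelMeasure, ← sum_Q0_restr_take u v hm, mul_left_comm]
  congr 1
  rw [Finset.mul_sum]
  refine Finset.sum_congr rfl fun w _ => ?_
  have h : ∀ i : Fin (N + 1), g (prepend (List.ofFn w) fun _ => i)
      = if (List.ofFn w).take v.length = v then 1 else 0 := by
    intro i
    have hi := initialWord_prepend_of_le (List.ofFn w) (fun _ => i) (n := v.length)
      (by simpa using hm)
    classical
    simp only [hg, Set.indicator_apply, cylinder, Set.mem_ofPred_eq, hi, Pi.one_apply]
  simp only [h]
  split_ifs
  · simp only [← Finset.sum_mul, Q0]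
    ring
  · simp

theorem real_univ_levelMeasure (u : Fin (N + 1) → ℝ) (m : ℕ) :
    (levelMeasure u m).real Set.univ = 2 * Q0 u := by
  have h := integral_levelMeasure_cylinder u [] (g := 1) (fun ω => by simp [cylinder, initialWord])
    (Nat.zero_le m)
  simpa using h

theorem exists_energyLimit (u : Fin (N + 1) → ℝ) :
    ∃ P : Measure (ℕ → Fin (N + 1)), IsFiniteMeasure P ∧ ∃ U : Ultrafilter ℕ, (U : Filter ℕ) ≤ atTop ∧
      ∀ g : C(ℕ → Fin (N + 1), ℝ),
        Tendsto (fun m => ∫ ω, g ω ∂levelMeasure u m) U (𝓝 (∫ ω, g ω ∂P)) := by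
  -- All level measures have total mass `2 * Q0 u`, so weak compactness gives a limit along an
  -- ultrafilter; convergence of the full sequence is not needed.
  have hK := isCompact_setOfPred_finiteMeasure_le_of_compactSpace (ℕ → Fin (N + 1))
    (2 * Q0 u).toNNReal
  let f : ℕ → FiniteMeasure (ℕ → Fin (N + 1)) := fun m => ⟨levelMeasure u m, inferInstance⟩
  have hf : ∀ m, (f m).mass ≤ (2 * Q0 u).toNNReal := by
    intro m
    rw [← real_univ_levelMeasure u m]
    refine le_of_eq ?_
    rw [Measure.real, Real.toNNReal, ← NNReal.coe_inj]
    simp [f, FiniteMeasure.mass]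
    rfl
  obtain ⟨P, -, hP⟩ := hK.ultrafilter_le_nhds ((hyperfilter ℕ).map f)
    (le_principal_iff.2 (Ultrafilter.mem_map.2 (Filter.univ_mem' hf)))
  refine ⟨P, inferInstance, hyperfilter ℕ, ?_, fun g => ?_⟩
  · rw [← Nat.cofinite_eq_atTop]
    exact hyperfilter_le_cofinite
  · have h := FiniteMeasure.tendsto_iff_forall_integral_tendsto.1 (show Tendsto f _ _ from hP)
      (BoundedContinuousFunction.mkOfCompact g)
    exact h

/-- A cylinder is clopen, so its indicator is a continuous test function, and its integrals are
constant from level `|v|` on. The value is therefore independent of the ultrafilter. -/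
theorem real_cylinder_of_tendsto {u : Fin (N + 1) → ℝ} {P : Measure (ℕ → Fin (N + 1))}
    {U : Ultrafilter ℕ} (hU : ↑U ≤ (atTop : Filter ℕ)) (hP : ∀ g : C(ℕ → Fin (N + 1), ℝ),
      Tendsto (fun m => ∫ ω, g ω ∂levelMeasure u m) U (𝓝 (∫ ω, g ω ∂P)))
    (v : List (Fin (N + 1))) :
    P.real (cylinder v) = 2 * ((((N : ℝ) + 3) / ((N : ℝ) + 1)) ^ v.length * Q0 (restr v u)) := by
  have hc : Continuous ((cylinder v).indicator (1 : (ℕ → Fin (N + 1)) → ℝ)) :=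
    continuous_const.indicator fun ω hω => by simp [(isClopen_cylinder v).frontier_eq] at hω
  have h := hP ⟨_, hc⟩
  simp only [ContinuousMap.coe_mk] at h
  rw [integral_indicator_one (isClopen_cylinder v).isOpen.measurableSet] at h
  refine tendsto_nhds_unique h (tendsto_const_nhds.congr' ?_)
  filter_upwards [hU (eventually_ge_atTop v.length)] with m hm
  exact (integral_levelMeasure_cylinder u v (g := ⟨_, hc⟩) (fun _ => rfl) hm).symm

/-- The squared contraction ratio from `Q0_restr_le` beats the single renormalization factor, so the
mass of a cylinder of length `n` is at most a constant times `((N+1)/(N+3))^n`. -/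
theorem nullSingletonClass_of_real_cylinder {u : Fin (N + 1) → ℝ} {P : Measure (ℕ → Fin (N + 1))}
    [IsFiniteMeasure P] (hP : ∀ v, P.real (cylinder v)
      = 2 * ((((N : ℝ) + 3) / ((N : ℝ) + 1)) ^ v.length * Q0 (restr v u))) : NullSingletonClass P := by
  refine ⟨fun ω => ?_⟩
  rw [← measureReal_eq_zero_iff]
  refine le_antisymm (ge_of_tendsto' (tendsto_contraction_ratio_pow (N := N) (2 * Q0 u))
    fun n => ?_) measureReal_nonneg
  have h1 : P.real {ω} ≤ P.real (cylinder (initialWord ω n)) := by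
    refine measureReal_mono (Set.singleton_subset_iff.2 ?_)
    simp [cylinder]
  refine h1.trans ?_
  have h2 := Q0_restr_le (initialWord ω n) u
  rw [hP, length_initialWord]
  rw [length_initialWord, mul_comm 2 n, pow_mul] at h2
  have h3 := mul_le_mul_of_nonneg_left h2
    (show 0 ≤ (((N : ℝ) + 3) / ((N : ℝ) + 1)) ^ n by positivity)
  have h4 : (((N : ℝ) + 3) / ((N : ℝ) + 1)) ^ n * ((((((N : ℝ) + 1) / ((N : ℝ) + 3)) ^ n) ^ 2) * Q0 u)
      = (((N : ℝ) + 1) / ((N : ℝ) + 3)) ^ n * Q0 u := by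
    rw [sq, ← mul_assoc, ← mul_assoc, ← mul_pow, ratio_mul_inv_ratio, one_pow, one_mul]
  rw [← pow_mul, mul_comm n 2, pow_mul, ← pow_mul, mul_comm 2 n, pow_mul, h4] at h3
  linarith

section Gasket

variable (p : Fin (N + 1) → EuclideanSpace ℝ (Fin N))

theorem isEnergyMeasure_map_codeK (hp : AffineIndependent ℝ p) {u : Fin (N + 1) → ℝ}
    {P : Measure (ℕ → Fin (N + 1))} [IsFiniteMeasure P]
    {U : Ultrafilter ℕ} (hU : ↑U ≤ (atTop : Filter ℕ)) (hP : ∀ g : C(ℕ → Fin (N + 1), ℝ),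
      Tendsto (fun m => ∫ ω, g ω ∂levelMeasure u m) U (𝓝 (∫ ω, g ω ∂P))) :
    IsEnergyMeasure p (harmFun p hp u) (P.map (codeK p)) := by
  refine ⟨inferInstance, fun g hg => ?_⟩
  have hh := harmFun_mem_domain p hp u
  rw [integral_map (codeK p).continuous.aemeasurable g.continuous.aestronglyMeasurable]
  refine tendsto_nhds_unique (hP (g.comp (codeK p))) ?_
  have h := (((tendsto_levelForm p hh (mul_mem_domain p hh hg)).const_mul 2).sub
    (tendsto_levelForm p (sq (harmFun p hp u) ▸ mul_mem_domain p hh hh) hg)).mono_left hU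
  refine h.congr fun m => ?_
  rw [two_mul_levelForm_sub, integral_levelMeasure]
  simp only [ContinuousMap.comp_apply, codeK_prepend_const, harmFun_vertex]

/-- The domain is a point-separating algebra, hence dense in `C(K)`. Uniqueness identifies the
measure picked by `Classical.epsilon` with the constructed one. -/
theorem IsEnergyMeasure.unique (hp : AffineIndependent ℝ p) {f : C(gasket p, ℝ)}
    {μ ν : Measure (gasket p)} (hμ : IsEnergyMeasure p f μ) (hν : IsEnergyMeasure p f ν) :
    μ = ν := by
  have := hμ.1
  have := hν.1
  have hcont : ∀ (μ : Measure (gasket p)) [IsFiniteMeasure μ],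
      Continuous fun g : C(gasket p, ℝ) => ∫ x, g x ∂μ := by
    intro μ _
    have hint : ∀ g : C(gasket p, ℝ), Integrable g μ := fun g =>
      g.continuous.integrable_of_hasCompactSupport (HasCompactSupport.of_compactSpace _)
    refine (LipschitzWith.of_dist_le_mul (K := (μ.real Set.univ).toNNReal) fun g g' => ?_).continuous
    rw [Real.dist_eq, ← integral_sub (hint g) (hint g'), ← Real.norm_eq_abs,
      Real.coe_toNNReal _ measureReal_nonneg, mul_comm]
    refine norm_integral_le_of_norm_le_const (Eventually.of_forall fun x => ?_)
    rw [← dist_eq_norm]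
    exact ContinuousMap.dist_apply_le_dist x
  have hdense : Dense (domain p) := by
    have h := ContinuousMap.subalgebra_topologicalClosure_eq_top_of_separatesPoints _
      (separatesPoints_domainSubalgebra p hp)
    rw [dense_iff_closure_eq]
    have := congrArg (fun A : Subalgebra ℝ C(gasket p, ℝ) => (A : Set C(gasket p, ℝ))) h
    rwa [Subalgebra.topologicalClosure_coe] at this
  have heq := Continuous.ext_on hdense (hcont μ) (hcont ν)
    fun g hg => (hμ.2 g hg).trans (hν.2 g hg).symm
  exact ext_of_forall_integral_eq_of_IsFiniteMeasure fun g => congrFun heq g.toContinuousMap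

theorem isClosed_cell (w : List (Fin (N + 1))) : IsClosed (cell p w) := by
  have hc : Continuous (psiWord p w) := by
    refine (LipschitzWith.of_dist_le_mul (K := (1 / 2) ^ w.length) fun x y => ?_).continuous
    rw [dist_psiWord]
    simp
  exact ((isCompact_gasket p).image hc).isClosed

theorem real_cell_map_codeK (hp : AffineIndependent ℝ p) {P : Measure (ℕ → Fin (N + 1))}
    [IsFiniteMeasure P] [NullSingletonClass P] (w : List (Fin (N + 1))) :
    (P.map (codeK p)).real (Subtype.val ⁻¹' cell p w) = P.real (cylinder w) := by
  have hm : MeasurableSet (Subtype.val ⁻¹' cell p w : Set (gasket p)) :=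
    ((isClosed_cell p w).preimage continuous_subtype_val).measurableSet
  rw [map_measureReal_apply (codeK p).continuous.measurable hm]
  refine measureReal_congr ?_
  have hsub : cylinder w ⊆ codeK p ⁻¹' (Subtype.val ⁻¹' cell p w) := by
    intro ω hω
    obtain ⟨η, rfl⟩ := mem_cylinder_iff.1 hω
    exact ⟨code p η, code_mem_gasket p η, (code_prepend p w η).symm⟩
  -- A sequence outside the cylinder that codes a point of the cell is a second code of that point,
  -- hence eventually constant. Such sequences are countable and so null.
  have hdiff : (codeK p ⁻¹' (Subtype.val ⁻¹' cell p w)) \ cylinder w ⊆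
      Set.range fun q : List (Fin (N + 1)) × Fin (N + 1) => prepend q.1 fun _ => q.2 := by
    rintro ω ⟨⟨y, hy, hyω⟩, hω⟩
    obtain ⟨η, rfl⟩ := exists_code_eq p hy
    rw [← code_prepend] at hyω
    obtain ⟨v, i, j, h1, -⟩ := exists_prepend_of_code_eq p hp hyω.symm
      fun e => hω (mem_cylinder_iff.2 ⟨η, e⟩)
    exact ⟨(v ++ [i], j), h1.symm⟩
  refine (ae_eq_set.2 ⟨measure_mono_null hdiff ?_, ?_⟩)
  · exact (Set.countable_range _).measure_zero P
  · rw [Set.sdiff_eq_empty.2 hsub, measure_empty]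

theorem energyMeasure_harmFun (hp : AffineIndependent ℝ p) (u : Fin (N + 1) → ℝ) :
    IsFiniteMeasure (energyMeasure p (harmFun p hp u)) ∧
    ∀ w, (energyMeasure p (harmFun p hp u)).real (Subtype.val ⁻¹' cell p w)
      = 2 * ((((N : ℝ) + 3) / ((N : ℝ) + 1)) ^ w.length * Q0 (restr w u)) := by
  obtain ⟨P, hfin, U, hU, hP⟩ := exists_energyLimit u
  have hE := isEnergyMeasure_map_codeK p hp hU hP
  have hcyl := real_cylinder_of_tendsto hU hP
  have := nullSingletonClass_of_real_cylinder hcyl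
  have heq : energyMeasure p (harmFun p hp u) = P.map (codeK p) :=
    (Classical.epsilon_spec (p := IsEnergyMeasure p (harmFun p hp u)) ⟨_, hE⟩).unique p hp hE
  rw [heq]
  exact ⟨hE.1, fun w => by rw [real_cell_map_codeK p hp w, hcyl]⟩

theorem cellRatio_eq (hp : AffineIndependent ℝ p) {h : C(gasket p, ℝ)} (hh : IsHarmonic p h)
    (w : List (Fin (N + 1))) :
    cellRatio p h w =
      Q0 (restr w (cellVal p h [])) / ∑ k, Q0 (restr w (Pi.single k 1)) := by
  have hν : (kusuokaMeasure p).real (Subtype.val ⁻¹' cell p w)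
      = 2 * ((((N : ℝ) + 3) / ((N : ℝ) + 1)) ^ w.length * ∑ k, Q0 (restr w (Pi.single k 1))) := by
    rw [kusuokaMeasure, Measure.real, Measure.finsetSum_apply, ENNReal.toReal_sum]
    · rw [Finset.mul_sum, Finset.mul_sum]
      refine Finset.sum_congr rfl fun k _ => ?_
      rw [harmonicExt_eq p hp]
      exact (energyMeasure_harmFun p hp _).2 w
    · intro k _
      rw [harmonicExt_eq p hp]
      have := (energyMeasure_harmFun p hp (Pi.single k 1)).1
      exact measure_ne_top _ _
  have hh' := hh.eq_harmFun p hp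
  rw [cellRatio, hν]
  conv_lhs => rw [hh']
  rw [(energyMeasure_harmFun p hp _).2 w, mul_div_mul_left _ _ two_ne_zero,
    mul_div_mul_left _ _ (by positivity)]

end Gasket

end EnergyMeasures

/-! ### Contraction of slopes along an edge. -/

section EdgeAsymptotics

section Slope

variable {N : ℕ}

/-- The action of `harm` on slopes of linear forms; `a = i` marks the first endpoint of the edge. -/
noncomputable def slopeStep (i a : Fin (N + 1)) (s : ℝ) : ℝ :=
  if a = i then (1 + s) / ((N : ℝ) + 1) else ((N : ℝ) + 1) * s / (1 + s)

/-- The derivative of `log (1 + t)` with respect to `log t` is `t/(1+t)`, at most `c/(c+1)`.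
Weighted AM–GM for `1` and `s/t` replaces the mean value theorem. -/
theorem log_one_add_sub_le {s t c : ℝ} (hs : 0 < s) (hst : s ≤ t) (ht : t ≤ c) :
    Real.log (1 + t) - Real.log (1 + s) ≤ c / (c + 1) * (Real.log t - Real.log s) := by
  have ht0 : 0 < t := hs.trans_le hst
  have hθ : t / (1 + t) ≤ c / (c + 1) := by
    rw [div_le_div_iff₀ (by positivity) (by linarith)]
    nlinarith
  have ham := Real.geom_mean_le_arith_mean2_weighted (w₁ := 1 / (1 + t)) (w₂ := t / (1 + t))
    (p₁ := 1) (p₂ := s / t) (by positivity) (by positivity) zero_le_one (by positivity)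
    (by field_simp)
  rw [Real.one_rpow, one_mul] at ham
  have he : 1 / (1 + t) * 1 + t / (1 + t) * (s / t) = (1 + s) / (1 + t) := by
    field_simp
  rw [he] at ham
  have hlog := Real.log_le_log (by positivity) ham
  rw [Real.log_rpow (by positivity), Real.log_div hs.ne' ht0.ne',
    Real.log_div (by positivity) (by positivity)] at hlog
  have hmono := Real.log_le_log hs hst
  have := mul_le_mul_of_nonneg_right hθ (sub_nonneg.2 hmono)
  linarith

theorem abs_log_one_add_sub_le {s t c : ℝ} (hs : 0 < s) (ht : 0 < t) (hsc : s ≤ c) (htc : t ≤ c) :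
    |Real.log (1 + s) - Real.log (1 + t)| ≤ c / (c + 1) * |Real.log s - Real.log t| := by
  wlog h : t ≤ s generalizing s t
  · rw [abs_sub_comm, abs_sub_comm (Real.log s)]
    exact this ht hs htc hsc (le_of_not_ge h)
  have h1 := Real.log_le_log ht h
  have h2 := Real.log_le_log (show 0 < 1 + t by positivity) (show 1 + t ≤ 1 + s by linarith)
  rw [abs_of_nonneg (by linarith), abs_of_nonneg (by linarith)]
  exact log_one_add_sub_le ht h hsc

/-- The branch `a = i` fixes `1/N` and maps the interval onto `[1/N, 1]`; the other branch fixes `N`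
and maps it onto `[1, N]`. -/
theorem slopeStep_mem (hN : 2 ≤ N) (i a : Fin (N + 1)) {s : ℝ} (hs : s ∈ Set.Icc (1 / (N : ℝ)) N) :
    slopeStep i a s ∈ Set.Icc (1 / (N : ℝ)) N := by
  have hN' : (2 : ℝ) ≤ N := by exact_mod_cast hN
  obtain ⟨h1, h2⟩ := hs
  have hs0 : 0 < s := lt_of_lt_of_le (by positivity) h1
  have h1' : 1 ≤ s * N := (div_le_iff₀ (by positivity)).1 h1
  unfold slopeStep
  split_ifs
  · refine ⟨?_, ?_⟩
    · rw [div_le_div_iff₀ (by positivity) (by positivity)]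
      nlinarith
    · rw [div_le_iff₀ (by positivity)]
      nlinarith
  · refine ⟨?_, ?_⟩
    · rw [div_le_div_iff₀ (by positivity) (by positivity)]
      nlinarith
    · rw [div_le_iff₀ (by positivity)]
      nlinarith

theorem abs_log_slopeStep_sub_le (hN : 2 ≤ N) (i a : Fin (N + 1)) {s t : ℝ}
    (hs : s ∈ Set.Icc (1 / (N : ℝ)) N) (ht : t ∈ Set.Icc (1 / (N : ℝ)) N) :
    |Real.log (slopeStep i a s) - Real.log (slopeStep i a t)|
      ≤ (N : ℝ) / ((N : ℝ) + 1) * |Real.log s - Real.log t| := by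
  have hN' : (2 : ℝ) ≤ N := by exact_mod_cast hN
  have hs0 : 0 < s := lt_of_lt_of_le (by positivity) hs.1
  have ht0 : 0 < t := lt_of_lt_of_le (by positivity) ht.1
  unfold slopeStep
  split_ifs
  · rw [Real.log_div (by positivity) (by positivity), Real.log_div (by positivity) (by positivity),
      sub_sub_sub_cancel_right]
    exact abs_log_one_add_sub_le hs0 ht0 hs.2 ht.2
  -- The second branch is the first one conjugated by `r ↦ 1/r`, which preserves the interval and
  -- reverses the sign of the logarithm.
  · have e : ∀ r : ℝ, 0 < r → Real.log (((N : ℝ) + 1) * r / (1 + r))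
        = Real.log ((N : ℝ) + 1) - Real.log (1 + r⁻¹) := by
      intro r hr
      rw [← Real.log_div (by positivity) (by positivity)]
      congr 1
      field_simp
      ring
    have hinv : ∀ r : ℝ, r ∈ Set.Icc (1 / (N : ℝ)) N → r⁻¹ ≤ N := by
      intro r hr
      rw [inv_le_comm₀ (lt_of_lt_of_le (by positivity) hr.1) (by positivity), ← one_div]
      exact hr.1
    rw [e s hs0, e t ht0, sub_sub_sub_cancel_left, abs_sub_comm]
    refine (abs_log_one_add_sub_le (inv_pos.2 hs0) (inv_pos.2 ht0) (hinv s hs) (hinv t ht)).trans_eq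
      ?_
    rw [Real.log_inv, Real.log_inv, neg_sub_neg, abs_sub_comm]

/-- The finite approximations of the slope. -/
noncomputable def slopeApprox (i : Fin (N + 1)) : ℕ → (ℕ → Fin (N + 1)) → ℝ
  | 0, _ => 1
  | n + 1, ω => slopeStep i (ω 0) (slopeApprox i n (shift ω))

theorem slopeApprox_mem (hN : 2 ≤ N) (i : Fin (N + 1)) (n : ℕ) (ω : ℕ → Fin (N + 1)) :
    slopeApprox i n ω ∈ Set.Icc (1 / (N : ℝ)) N := by
  induction n generalizing ω with
  | zero =>
    have hN' : (2 : ℝ) ≤ N := by exact_mod_cast hN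
    exact ⟨(div_le_one (by positivity)).2 (by linarith), by simp only [slopeApprox]; linarith⟩
  | succ n ih => exact slopeStep_mem hN i _ (ih _)

theorem abs_log_le_of_mem {s : ℝ} (hN : 2 ≤ N) (hs : s ∈ Set.Icc (1 / (N : ℝ)) N) :
    |Real.log s| ≤ Real.log N := by
  have hN' : (2 : ℝ) ≤ N := by exact_mod_cast hN
  have hs0 : 0 < s := lt_of_lt_of_le (by positivity) hs.1
  have h1 := Real.log_le_log (by positivity) hs.1
  have h2 := Real.log_le_log hs0 hs.2
  rw [one_div, Real.log_inv] at h1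
  exact abs_le.2 ⟨h1, h2⟩

theorem dist_log_slopeApprox_succ_le (hN : 2 ≤ N) (i : Fin (N + 1)) (ω : ℕ → Fin (N + 1)) (n : ℕ) :
    dist (Real.log (slopeApprox i n ω)) (Real.log (slopeApprox i (n + 1) ω))
      ≤ Real.log N * ((N : ℝ) / ((N : ℝ) + 1)) ^ n := by
  induction n generalizing ω with
  | zero =>
    have := abs_log_le_of_mem hN (slopeApprox_mem hN i 1 ω)
    simpa [slopeApprox, Real.dist_eq] using this
  | succ n ih =>
    refine (abs_log_slopeStep_sub_le hN i (ω 0) (slopeApprox_mem hN i n _)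
      (slopeApprox_mem hN i (n + 1) _)).trans ?_
    have h := mul_le_mul_of_nonneg_left (ih (shift ω))
      (show 0 ≤ (N : ℝ) / ((N : ℝ) + 1) by positivity)
    rw [Real.dist_eq] at h
    refine h.trans_eq ?_
    ring

/-- The logarithm of the slope of the limiting linear form along `ω`. -/
noncomputable def logSlope (i : Fin (N + 1)) (ω : ℕ → Fin (N + 1)) : ℝ :=
  limUnder atTop fun n => Real.log (slopeApprox i n ω)

/-- The slope of the limiting linear form along `ω`. -/
noncomputable def slope (i : Fin (N + 1)) (ω : ℕ → Fin (N + 1)) : ℝ := Real.exp (logSlope i ω)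

theorem holder_ratio_lt_one : (N : ℝ) / ((N : ℝ) + 1) < 1 :=
  (div_lt_one (by positivity)).2 (by linarith)

theorem tendsto_logSlope (hN : 2 ≤ N) (i : Fin (N + 1)) (ω : ℕ → Fin (N + 1)) :
    Tendsto (fun n => Real.log (slopeApprox i n ω)) atTop (𝓝 (logSlope i ω)) :=
  (cauchySeq_of_le_geometric _ _ holder_ratio_lt_one
    (dist_log_slopeApprox_succ_le hN i ω)).tendsto_limUnder

theorem tendsto_slope (hN : 2 ≤ N) (i : Fin (N + 1)) (ω : ℕ → Fin (N + 1)) :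
    Tendsto (fun n => slopeApprox i n ω) atTop (𝓝 (slope i ω)) := by
  refine ((Real.continuous_exp.tendsto _).comp (tendsto_logSlope hN i ω)).congr fun n => ?_
  have hN' : (2 : ℝ) ≤ N := by exact_mod_cast hN
  exact Real.exp_log (lt_of_lt_of_le (by positivity) (slopeApprox_mem hN i n ω).1)

theorem slope_mem (hN : 2 ≤ N) (i : Fin (N + 1)) (ω : ℕ → Fin (N + 1)) :
    slope i ω ∈ Set.Icc (1 / (N : ℝ)) N :=
  isClosed_Icc.mem_of_tendsto (tendsto_slope hN i ω)
    (Eventually.of_forall fun n => slopeApprox_mem hN i n ω)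

theorem slope_pos (i : Fin (N + 1)) (ω : ℕ → Fin (N + 1)) : 0 < slope i ω := Real.exp_pos _

theorem log_slope (i : Fin (N + 1)) (ω : ℕ → Fin (N + 1)) : Real.log (slope i ω) = logSlope i ω :=
  Real.log_exp _

theorem slope_eq (hN : 2 ≤ N) (i : Fin (N + 1)) (ω : ℕ → Fin (N + 1)) :
    slope i ω = slopeStep i (ω 0) (slope i (shift ω)) := by
  refine tendsto_nhds_unique ((tendsto_add_atTop_iff_nat 1).2 (tendsto_slope hN i ω)) ?_
  have h := tendsto_slope hN i (shift ω)
  have hpos := slope_pos i (shift ω)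
  simp only [slopeApprox, slopeStep]
  split_ifs
  · exact (h.const_add 1).div_const _
  · exact (h.const_mul _).div (h.const_add 1) (by positivity)

theorem abs_logSlope_sub_le_of_eq (hN : 2 ≤ N) (i : Fin (N + 1)) {ω η : ℕ → Fin (N + 1)}
    (h0 : ω 0 = η 0) :
    |logSlope i ω - logSlope i η|
      ≤ (N : ℝ) / ((N : ℝ) + 1) * |logSlope i (shift ω) - logSlope i (shift η)| := by
  rw [← log_slope, ← log_slope i η, slope_eq hN i ω, slope_eq hN i η, h0, ← log_slope i (shift ω),
    ← log_slope i (shift η)]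
  exact abs_log_slopeStep_sub_le hN i _ (slope_mem hN i _) (slope_mem hN i _)

theorem abs_logSlope_le (hN : 2 ≤ N) (i : Fin (N + 1)) (ω : ℕ → Fin (N + 1)) :
    |logSlope i ω| ≤ Real.log N := by
  rw [← log_slope]
  exact abs_log_le_of_mem hN (slope_mem hN i ω)

theorem slope_const_self (hN : 2 ≤ N) (i : Fin (N + 1)) : slope i (fun _ => i) = 1 / (N : ℝ) := by
  have h := slope_eq hN i fun _ => i
  change slope i (fun _ => i) = slopeStep i i (slope i fun _ => i) at h
  have hN' : (2 : ℝ) ≤ N := by exact_mod_cast hN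
  rw [slopeStep, if_pos rfl, eq_div_iff (by positivity)] at h
  rw [eq_div_iff (by positivity)]
  linarith

theorem slope_const_of_ne (hN : 2 ≤ N) {i j : Fin (N + 1)} (hij : i ≠ j) :
    slope i (fun _ => j) = N := by
  have h := slope_eq hN i fun _ => j
  change slope i (fun _ => j) = slopeStep i j (slope i fun _ => j) at h
  have hpos := slope_pos i fun _ => j
  rw [slopeStep, if_neg hij.symm, eq_div_iff (by positivity), mul_comm] at h
  have := mul_right_cancel₀ hpos.ne' h
  linarith

/-- With `logSlope_seqCons_of_ne`: the two codes of the midpoint of the edge both have slope `1`.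
This is where the two halves of the edge are glued. -/
theorem logSlope_seqCons_self (hN : 2 ≤ N) {i j : Fin (N + 1)} (hij : i ≠ j) :
    logSlope i (seqCons i fun _ => j) = 0 := by
  rw [← log_slope, slope_eq hN, seqCons_zero, shift_seqCons, slope_const_of_ne hN hij, slopeStep,
    if_pos rfl, add_comm, div_self (by positivity), Real.log_one]

theorem logSlope_seqCons_of_ne (hN : 2 ≤ N) {i j : Fin (N + 1)} (hij : i ≠ j) :
    logSlope i (seqCons j fun _ => i) = 0 := by
  have hN' : (2 : ℝ) ≤ N := by exact_mod_cast hN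
  rw [← log_slope, slope_eq hN, seqCons_zero, shift_seqCons, slope_const_self hN, slopeStep,
    if_neg hij.symm]
  have : ((N : ℝ) + 1) * (1 / N) / (1 + 1 / N) = 1 := by
    field_simp
  rw [this, Real.log_one]

end Slope

/-! ### The dominant linear form along a sequence and its limit ratio. -/

section LinearForm

variable {N : ℕ}

/-- The mean of `u` off the edge `{i, j}`. -/
noncomputable def offMean (i j : Fin (N + 1)) (u : Fin (N + 1) → ℝ) : ℝ :=
  (∑ k, u k - u i - u j) / ((N : ℝ) - 1)

theorem offMean_symm (i j : Fin (N + 1)) (u : Fin (N + 1) → ℝ) : offMean i j u = offMean j i u := by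
  rw [offMean, offMean, sub_right_comm]

/-- The coordinate of `u` at the endpoint `i` of the edge `{i, j}`. -/
noncomputable def edgeCoord (i j : Fin (N + 1)) (u : Fin (N + 1) → ℝ) : ℝ := u i - offMean i j u

theorem edgeCoord_harm_self (hN : 2 ≤ N) {i j : Fin (N + 1)} (hij : i ≠ j) (u : Fin (N + 1) → ℝ) :
    edgeCoord i j (harm i u)
      = (((N : ℝ) + 1) * edgeCoord i j u - edgeCoord j i u) / ((N : ℝ) + 3) := by
  have hN' : (2 : ℝ) ≤ N := by exact_mod_cast hN
  have h1 : (N : ℝ) - 1 ≠ 0 := by linarith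
  have h3 : (N : ℝ) + 3 ≠ 0 := by positivity
  simp only [edgeCoord, offMean, sum_harm, harm_self, harm_of_ne hij.symm]
  field_simp
  ring

theorem edgeCoord_harm_other (hN : 2 ≤ N) {i j : Fin (N + 1)} (hij : i ≠ j) (u : Fin (N + 1) → ℝ) :
    edgeCoord j i (harm i u) = edgeCoord j i u / ((N : ℝ) + 3) := by
  have hN' : (2 : ℝ) ≤ N := by exact_mod_cast hN
  have h1 : (N : ℝ) - 1 ≠ 0 := by linarith
  have h3 : (N : ℝ) + 3 ≠ 0 := by positivity
  simp only [edgeCoord, offMean, sum_harm, harm_self, harm_of_ne hij.symm]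
  field_simp
  ring

theorem abs_sub_offMean_le (hN : 2 ≤ N) {i j : Fin (N + 1)} (hij : i ≠ j) {u : Fin (N + 1) → ℝ}
    {k : Fin (N + 1)} {M : ℝ} (h : ∀ l, l ≠ i → l ≠ j → |u k - u l| ≤ M) :
    |u k - offMean i j u| ≤ M := by
  have hN' : (2 : ℝ) ≤ N := by exact_mod_cast hN
  set A : Finset (Fin (N + 1)) := (Finset.univ.erase i).erase j with hA
  have hj : j ∈ Finset.univ.erase i := by simp [hij.symm]
  have hcard : (A.card : ℝ) = (N : ℝ) - 1 := by
    rw [hA, Finset.card_erase_of_mem hj, Finset.card_erase_of_mem (Finset.mem_univ i),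
      Finset.card_univ, Fintype.card_fin, Nat.add_sub_cancel, Nat.cast_sub (by omega), Nat.cast_one]
  have hsum : ∑ l, u l - u i - u j = ∑ l ∈ A, u l := by
    rw [← Finset.add_sum_erase _ u (Finset.mem_univ i), ← Finset.add_sum_erase _ u hj]
    ring
  have he : u k - offMean i j u = (∑ l ∈ A, (u k - u l)) / ((N : ℝ) - 1) := by
    have h1 : (N : ℝ) - 1 ≠ 0 := by linarith
    rw [Finset.sum_sub_distrib, Finset.sum_const, nsmul_eq_mul, hcard, offMean, hsum]
    field_simp
  rw [he, abs_div, abs_of_pos (show 0 < (N : ℝ) - 1 by linarith), div_le_iff₀ (by linarith)]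
  refine (Finset.abs_sum_le_sum_abs _ _).trans ?_
  refine (Finset.sum_le_card_nsmul A _ M fun l hl => h l ?_ ?_).trans_eq ?_
  · exact Finset.ne_of_mem_erase (Finset.mem_of_mem_erase hl)
  · exact Finset.ne_of_mem_erase hl
  · rw [nsmul_eq_mul, hcard, mul_comm]

theorem abs_edgeCoord_le (hN : 2 ≤ N) {i j : Fin (N + 1)} (hij : i ≠ j) (u : Fin (N + 1) → ℝ) :
    |edgeCoord i j u| ≤ √(Q0 u) :=
  abs_sub_offMean_le hN hij fun l _ _ => abs_sub_le_sqrt_Q0 u i l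

/-- The linear form of slope `s` on the edge `{i, j}`. -/
noncomputable def edgeForm (i j : Fin (N + 1)) (s : ℝ) (u : Fin (N + 1) → ℝ) : ℝ :=
  edgeCoord i j u - s * edgeCoord j i u

theorem offMean_add (i j : Fin (N + 1)) (u v : Fin (N + 1) → ℝ) :
    offMean i j (u + v) = offMean i j u + offMean i j v := by
  simp only [offMean, Pi.add_apply, Finset.sum_add_distrib]
  ring

theorem offMean_smul (i j : Fin (N + 1)) (c : ℝ) (u : Fin (N + 1) → ℝ) :
    offMean i j (c • u) = c * offMean i j u := by
  simp only [offMean, Pi.smul_apply, smul_eq_mul, ← Finset.mul_sum]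
  ring

/-- The linear form `edgeForm` as a linear map. -/
noncomputable def edgeFormₗ (i j : Fin (N + 1)) (s : ℝ) : (Fin (N + 1) → ℝ) →ₗ[ℝ] ℝ where
  toFun := edgeForm i j s
  map_add' u v := by
    simp only [edgeForm, edgeCoord, offMean_add, Pi.add_apply]
    ring
  map_smul' c u := by
    simp only [edgeForm, edgeCoord, offMean_smul, Pi.smul_apply, smul_eq_mul, RingHom.id_apply]
    ring

theorem edgeForm_single {i j : Fin (N + 1)} (hij : i ≠ j) (s : ℝ) :
    edgeForm i j s (Pi.single i 1) = 1 := by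
  simp [edgeForm, edgeCoord, offMean, hij.symm]

/-- The factor by which `edgeForm` is multiplied in one step. -/
noncomputable def stepFactor (i a : Fin (N + 1)) (s : ℝ) : ℝ :=
  if a = i then ((N : ℝ) + 1) / ((N : ℝ) + 3) else (1 + s) / ((N : ℝ) + 3)

theorem edgeForm_harm (hN : 2 ≤ N) {i j a : Fin (N + 1)} (hij : i ≠ j) (ha : a = i ∨ a = j) {s : ℝ}
    (hs : 0 < s) (u : Fin (N + 1) → ℝ) :
    edgeForm i j s (harm a u) = stepFactor i a s * edgeForm i j (slopeStep i a s) u := by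
  have h3 : (N : ℝ) + 3 ≠ 0 := by positivity
  have h1 : (N : ℝ) + 1 ≠ 0 := by positivity
  have hs1 : 1 + s ≠ 0 := by positivity
  rcases ha with rfl | rfl
  · simp only [edgeForm, stepFactor, slopeStep, if_true, edgeCoord_harm_self hN hij,
      edgeCoord_harm_other hN hij]
    field_simp
    ring
  · simp only [edgeForm, stepFactor, slopeStep, if_neg hij.symm, edgeCoord_harm_self hN hij.symm,
      edgeCoord_harm_other hN hij.symm]
    field_simp
    ring

theorem harm_sub_of_ne {a k l : Fin (N + 1)} (hk : k ≠ a) (hl : l ≠ a) (u : Fin (N + 1) → ℝ) :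
    harm a u k - harm a u l = (u k - u l) / ((N : ℝ) + 3) := by
  rw [harm_of_ne hk, harm_of_ne hl]
  ring

/-- Spectral gap: the weak rate `1/(N+3)` is smaller than the growth rate of the dominant form by at
least the factor `N/(N+1)`. -/
theorem one_le_mul_stepFactor (hN : 2 ≤ N) (i a : Fin (N + 1)) {s : ℝ}
    (hs : s ∈ Set.Icc (1 / (N : ℝ)) N) :
    1 / ((N : ℝ) + 3) ≤ (N : ℝ) / ((N : ℝ) + 1) * stepFactor i a s := by
  have hN' : (2 : ℝ) ≤ N := by exact_mod_cast hN
  have h1 : 1 ≤ s * N := (div_le_iff₀ (by positivity)).1 hs.1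
  unfold stepFactor
  split_ifs
  · rw [div_mul_div_comm, mul_comm (N : ℝ), mul_div_mul_left _ _ (by positivity)]
    gcongr
    linarith
  · rw [div_mul_div_comm, div_le_div_iff₀ (by positivity) (by positivity)]
    nlinarith

/-- On the kernel `X` is determined by `Y`. For `a = i` the coordinate is multiplied by `s/(1+s)`
times the step factor, and `s ≤ N` gives the gap; for `a = j` it is just divided by `N + 3`. -/
theorem abs_edgeCoord_harm_le (hN : 2 ≤ N) {i j a : Fin (N + 1)} (hij : i ≠ j)
    (ha : a = i ∨ a = j) {s : ℝ} (hs : s ∈ Set.Icc (1 / (N : ℝ)) N) {u : Fin (N + 1) → ℝ}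
    (hu : edgeForm i j (slopeStep i a s) u = 0) :
    |edgeCoord i j (harm a u)|
      ≤ (N : ℝ) / ((N : ℝ) + 1) * stepFactor i a s * |edgeCoord i j u| := by
  have hN' : (2 : ℝ) ≤ N := by exact_mod_cast hN
  have hs0 : 0 < s := lt_of_lt_of_le (by positivity) hs.1
  rcases ha with rfl | rfl
  · have h0 : edgeForm a j s (harm a u) = 0 := by rw [edgeForm_harm hN hij (Or.inl rfl) hs0, hu, mul_zero]
    rw [edgeForm, edgeCoord_harm_other hN hij] at h0
    rw [edgeForm, slopeStep, if_pos rfl] at hu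
    rw [stepFactor, if_pos rfl]
    have e : edgeCoord a j (harm a u)
        = s / (1 + s) * (((N : ℝ) + 1) / ((N : ℝ) + 3)) * edgeCoord a j u := by
      rw [sub_eq_zero.1 h0, sub_eq_zero.1 hu]
      field_simp
    rw [e, abs_mul, abs_of_nonneg (by positivity)]
    have hle : s / (1 + s) ≤ (N : ℝ) / ((N : ℝ) + 1) := by
      rw [div_le_div_iff₀ (by positivity) (by positivity)]
      nlinarith [hs.2]
    gcongr
  · rw [edgeCoord_harm_other hN hij.symm, abs_div, abs_of_pos (show 0 < (N : ℝ) + 3 by positivity),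
      div_eq_mul_one_div, mul_comm]
    exact mul_le_mul_of_nonneg_right (one_le_mul_stepFactor hN i a hs) (abs_nonneg _)

/-- The factor by which the limiting linear form along `ω` is multiplied in `n` steps. -/
noncomputable def growth (i : Fin (N + 1)) : ℕ → (ℕ → Fin (N + 1)) → ℝ
  | 0, _ => 1
  | n + 1, ω => stepFactor i (ω 0) (slope i (shift ω)) * growth i n (shift ω)

theorem stepFactor_pos (i a : Fin (N + 1)) {s : ℝ} (hs : 0 < s) : 0 < stepFactor i a s := by
  unfold stepFactor
  split_ifs <;> positivity

theorem growth_pos (i : Fin (N + 1)) (n : ℕ) (ω : ℕ → Fin (N + 1)) : 0 < growth i n ω := by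
  induction n generalizing ω with
  | zero => exact zero_lt_one
  | succ n ih => exact mul_pos (stepFactor_pos i _ (slope_pos i _)) (ih _)

theorem shift_mem_edgeSeq {i j : Fin (N + 1)} {ω : ℕ → Fin (N + 1)} (h : ω ∈ edgeSeq i j) :
    shift ω ∈ edgeSeq i j := fun n => h (n + 1)

theorem edgeForm_restr (hN : 2 ≤ N) {i j : Fin (N + 1)} (hij : i ≠ j) (n : ℕ)
    {ω : ℕ → Fin (N + 1)} (hω : ω ∈ edgeSeq i j) (u : Fin (N + 1) → ℝ) :
    edgeForm i j (slope i (shift^[n] ω)) (restr (initialWord ω n) u)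
      = growth i n ω * edgeForm i j (slope i ω) u := by
  induction n generalizing ω u with
  | zero => simp [growth, initialWord_zero]
  | succ n ih =>
    rw [Function.iterate_succ_apply, initialWord_succ, restr_cons, ih (shift_mem_edgeSeq hω),
      edgeForm_harm hN hij (hω 0) (slope_pos i _), ← slope_eq hN, growth]
    ring

theorem abs_edgeCoord_restr_le (hN : 2 ≤ N) {i j : Fin (N + 1)} (hij : i ≠ j) (n : ℕ)
    {ω : ℕ → Fin (N + 1)} (hω : ω ∈ edgeSeq i j) {u : Fin (N + 1) → ℝ}
    (hu : edgeForm i j (slope i ω) u = 0) :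
    |edgeCoord i j (restr (initialWord ω n) u)|
      ≤ ((N : ℝ) / ((N : ℝ) + 1)) ^ n * growth i n ω * |edgeCoord i j u| := by
  induction n generalizing ω u with
  | zero => simp [growth, initialWord_zero]
  | succ n ih =>
    rw [slope_eq hN] at hu
    have h0 : edgeForm i j (slope i (shift ω)) (harm (ω 0) u) = 0 := by
      rw [edgeForm_harm hN hij (hω 0) (slope_pos i _), hu, mul_zero]
    rw [initialWord_succ, restr_cons]
    refine (ih (shift_mem_edgeSeq hω) h0).trans ?_
    refine (mul_le_mul_of_nonneg_left
      (abs_edgeCoord_harm_le hN hij (hω 0) (slope_mem hN i _) hu) ?_).trans_eq ?_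
    · have := growth_pos i n (shift ω)
      positivity
    · rw [growth]
      ring

theorem abs_restr_sub_le (hN : 2 ≤ N) {i j k l : Fin (N + 1)} (hki : k ≠ i) (hkj : k ≠ j)
    (hli : l ≠ i) (hlj : l ≠ j) (n : ℕ) {ω : ℕ → Fin (N + 1)} (hω : ω ∈ edgeSeq i j)
    (u : Fin (N + 1) → ℝ) :
    |restr (initialWord ω n) u k - restr (initialWord ω n) u l|
      ≤ ((N : ℝ) / ((N : ℝ) + 1)) ^ n * growth i n ω * |u k - u l| := by
  induction n generalizing ω u with
  | zero => simp [growth, initialWord_zero]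
  | succ n ih =>
    rw [initialWord_succ, restr_cons]
    refine (ih (shift_mem_edgeSeq hω) _).trans ?_
    have hk : k ≠ ω 0 := by rcases hω 0 with h | h <;> rw [h] <;> assumption
    have hl : l ≠ ω 0 := by rcases hω 0 with h | h <;> rw [h] <;> assumption
    rw [harm_sub_of_ne hk hl, abs_div, abs_of_pos (show 0 < (N : ℝ) + 3 by positivity),
      ← one_div_mul_eq_div ((N : ℝ) + 3) |u k - u l|]
    refine (mul_le_mul_of_nonneg_left (mul_le_mul_of_nonneg_right
      (one_le_mul_stepFactor hN i (ω 0) (slope_mem hN i (shift ω))) (abs_nonneg _)) ?_).trans_eq ?_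
    · have := growth_pos i n (shift ω)
      positivity
    · rw [growth]
      ring

theorem Q0_restr_le_of_edgeForm_eq_zero (hN : 2 ≤ N) {i j : Fin (N + 1)} (hij : i ≠ j) (n : ℕ)
    {ω : ℕ → Fin (N + 1)} (hω : ω ∈ edgeSeq i j) {u : Fin (N + 1) → ℝ}
    (hu : edgeForm i j (slope i ω) u = 0) :
    Q0 (restr (initialWord ω n) u) ≤ ((N : ℝ) + 1) ^ 2 *
      (2 * (N * (((N : ℝ) / ((N : ℝ) + 1)) ^ n * growth i n ω * √(Q0 u)))) ^ 2 := by
  have hN' : (2 : ℝ) ≤ N := by exact_mod_cast hN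
  set v := restr (initialWord ω n) u with hv
  set M := ((N : ℝ) / ((N : ℝ) + 1)) ^ n * growth i n ω * √(Q0 u) with hM
  have hg := growth_pos i n ω
  have hM0 : 0 ≤ M := by positivity
  have hMN : M ≤ N * M := le_mul_of_one_le_left hM0 (by linarith)
  have hX : |edgeCoord i j v| ≤ M := by
    refine (abs_edgeCoord_restr_le hN hij n hω hu).trans ?_
    exact mul_le_mul_of_nonneg_left (abs_edgeCoord_le hN hij u) (by positivity)
  have hY : |edgeCoord j i v| ≤ N * M := by
    have h0 := edgeForm_restr hN hij n hω u
    rw [hu, mul_zero, ← hv, edgeForm, sub_eq_zero] at h0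
    have hs := slope_mem hN i (shift^[n] ω)
    have hs1 : 1 ≤ slope i (shift^[n] ω) * N := (div_le_iff₀ (by positivity)).1 hs.1
    have hspos := slope_pos i (shift^[n] ω)
    have : |edgeCoord j i v| ≤ N * |edgeCoord i j v| := by
      rw [h0, abs_mul, abs_of_pos hspos, ← mul_assoc, mul_comm (N : ℝ)]
      exact le_mul_of_one_le_left (abs_nonneg _) hs1
    exact this.trans (by gcongr)
  -- The extra factor `N` comes from recovering `Y = X / s` with `s ≥ 1/N`; off the edge the
  -- differences satisfy the bound `M` already.
  have hall : ∀ k, |v k - offMean i j v| ≤ N * M := by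
    intro k
    by_cases hki : k = i
    · rw [hki]
      exact hX.trans hMN
    by_cases hkj : k = j
    · rw [hkj, offMean_symm]
      exact hY
    refine (abs_sub_offMean_le hN hij fun l hli hlj => ?_).trans hMN
    refine (abs_restr_sub_le hN hki hkj hli hlj n hω u).trans ?_
    exact mul_le_mul_of_nonneg_left (abs_sub_le_sqrt_Q0 u k l) (by positivity)
  refine Q0_le v fun k l => sq_le_sq' ?_ ?_
  · have h1 := abs_le.1 (hall k)
    have h2 := abs_le.1 (hall l)
    linarith
  · have h1 := abs_le.1 (hall k)
    have h2 := abs_le.1 (hall l)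
    linarith

/-- The limiting form equals `1` on the `i`-th coordinate vector, so `growth` is the form of its
restriction, bounded by `(1 + s) √Q0` with `s ≤ N`. Thus this vector grows at the dominant rate and
can serve as the reference. -/
theorem sq_growth_le (hN : 2 ≤ N) {i j : Fin (N + 1)} (hij : i ≠ j) (n : ℕ)
    {ω : ℕ → Fin (N + 1)} (hω : ω ∈ edgeSeq i j) :
    growth i n ω ^ 2 ≤ ((N : ℝ) + 1) ^ 2 * Q0 (restr (initialWord ω n) (Pi.single i 1)) := by
  have hN' : (2 : ℝ) ≤ N := by exact_mod_cast hN
  set v := restr (initialWord ω n) (Pi.single i 1) with hv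
  have h := edgeForm_restr hN hij n hω (Pi.single i 1)
  rw [edgeForm_single hij, mul_one, ← hv, edgeForm] at h
  have h1 := abs_le.1 (abs_edgeCoord_le hN hij v)
  have h2 := abs_le.1 (abs_edgeCoord_le hN hij.symm v)
  have hs := slope_mem hN i (shift^[n] ω)
  have hs0 := slope_pos i (shift^[n] ω)
  have hle : growth i n ω ≤ ((N : ℝ) + 1) * √(Q0 v) := by
    rw [← h]
    nlinarith [hs.2, Real.sqrt_nonneg (Q0 v)]
  have := pow_le_pow_left₀ (growth_pos i n ω).le hle 2
  rwa [mul_pow, Real.sq_sqrt (Q0_nonneg v)] at this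

theorem Q0_restr_single_pos (hN : 2 ≤ N) {i j : Fin (N + 1)} (hij : i ≠ j) (n : ℕ)
    {ω : ℕ → Fin (N + 1)} (hω : ω ∈ edgeSeq i j) :
    0 < Q0 (restr (initialWord ω n) (Pi.single i 1)) := by
  have h := sq_growth_le hN hij n hω
  have h1 := growth_pos i n ω
  by_contra hc
  have h2 : ((N : ℝ) + 1) ^ 2 * Q0 (restr (initialWord ω n) (Pi.single i 1)) ≤ 0 :=
    mul_nonpos_of_nonneg_of_nonpos (by positivity) (not_lt.1 hc)
  have h3 : 0 < growth i n ω ^ 2 := by positivity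
  linarith

theorem tendsto_Q0_ratio_zero (hN : 2 ≤ N) {i j : Fin (N + 1)} (hij : i ≠ j)
    {ω : ℕ → Fin (N + 1)} (hω : ω ∈ edgeSeq i j) {u : Fin (N + 1) → ℝ}
    (hu : edgeForm i j (slope i ω) u = 0) :
    Tendsto (fun n => Q0 (restr (initialWord ω n) u)
      / Q0 (restr (initialWord ω n) (Pi.single i 1))) atTop (𝓝 0) := by
  set C : ℝ := ((N : ℝ) + 1) ^ 4 * 4 * N ^ 2 * Q0 u with hC
  have hlim : Tendsto (fun n : ℕ => (((N : ℝ) / ((N : ℝ) + 1)) ^ 2) ^ n * C) atTop (𝓝 0) := by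
    simpa using (tendsto_pow_atTop_nhds_zero_of_lt_one (by positivity)
      (pow_lt_one₀ (by positivity) (holder_ratio_lt_one (N := N)) two_ne_zero)).mul_const C
  refine squeeze_zero (fun n => div_nonneg (Q0_nonneg _) (Q0_nonneg _)) (fun n => ?_) hlim
  rw [div_le_iff₀ (Q0_restr_single_pos hN hij n hω)]
  refine (Q0_restr_le_of_edgeForm_eq_zero hN hij n hω hu).trans ?_
  have h1 := sq_growth_le hN hij n hω
  set q := Q0 (restr (initialWord ω n) (Pi.single i 1))
  have hnn : 0 ≤ (((N : ℝ) / ((N : ℝ) + 1)) ^ 2) ^ n * (((N : ℝ) + 1) ^ 2 * 4 * N ^ 2 * Q0 u) := by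
    have := Q0_nonneg u
    positivity
  calc _ = (((N : ℝ) / ((N : ℝ) + 1)) ^ 2) ^ n * (((N : ℝ) + 1) ^ 2 * 4 * N ^ 2 * (√(Q0 u)) ^ 2)
        * growth i n ω ^ 2 := by
        rw [← pow_mul, mul_comm 2 n, pow_mul]
        ring
    _ = (((N : ℝ) / ((N : ℝ) + 1)) ^ 2) ^ n * (((N : ℝ) + 1) ^ 2 * 4 * N ^ 2 * Q0 u)
        * growth i n ω ^ 2 := by rw [Real.sq_sqrt (Q0_nonneg u)]
    _ ≤ (((N : ℝ) / ((N : ℝ) + 1)) ^ 2) ^ n * (((N : ℝ) + 1) ^ 2 * 4 * N ^ 2 * Q0 u)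
        * (((N : ℝ) + 1) ^ 2 * q) := mul_le_mul_of_nonneg_left h1 hnn
    _ = _ := by
        rw [hC]
        ring

theorem tendsto_Q0_ratio (hN : 2 ≤ N) {i j : Fin (N + 1)} (hij : i ≠ j)
    {ω : ℕ → Fin (N + 1)} (hω : ω ∈ edgeSeq i j) (u : Fin (N + 1) → ℝ) :
    Tendsto (fun n => Q0 (restr (initialWord ω n) u)
      / Q0 (restr (initialWord ω n) (Pi.single i 1))) atTop
      (𝓝 (edgeForm i j (slope i ω) u ^ 2)) := by
  set c := edgeForm i j (slope i ω) u with hc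
  -- Splitting off the reference vector leaves a kernel vector. Its energy is negligible, and so is
  -- the cross term by Cauchy–Schwarz for `B0`.
  set e : Fin (N + 1) → ℝ := u - c • Pi.single i 1 with he
  have hform : edgeForm i j (slope i ω) e = 0 := by
    change edgeFormₗ i j (slope i ω) e = 0
    rw [he, map_sub, map_smul]
    change edgeForm i j (slope i ω) u - c • edgeForm i j (slope i ω) (Pi.single i 1) = 0
    rw [edgeForm_single hij, ← hc, smul_eq_mul, mul_one, sub_self]
  have h0 := tendsto_Q0_ratio_zero hN hij hω hform
  have hsplit : ∀ n, Q0 (restr (initialWord ω n) u)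
      / Q0 (restr (initialWord ω n) (Pi.single i 1)) = c ^ 2
        + 2 * c * (B0 (restr (initialWord ω n) (Pi.single i 1)) (restr (initialWord ω n) e)
          / Q0 (restr (initialWord ω n) (Pi.single i 1)))
        + Q0 (restr (initialWord ω n) e) / Q0 (restr (initialWord ω n) (Pi.single i 1)) := by
    intro n
    have hpos := Q0_restr_single_pos hN hij n hω
    have : u = c • Pi.single i 1 + e := by rw [he]; abel
    conv_lhs => rw [this, map_add, map_smul, Q0_add, Q0_smul, B0_smul_left]
    field_simp
  have hB : Tendsto (fun n => B0 (restr (initialWord ω n) (Pi.single i 1))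
      (restr (initialWord ω n) e) / Q0 (restr (initialWord ω n) (Pi.single i 1))) atTop (𝓝 0) := by
    have hsq : Tendsto (fun n => √(Q0 (restr (initialWord ω n) e)
        / Q0 (restr (initialWord ω n) (Pi.single i 1)))) atTop (𝓝 0) := by
      simpa using h0.sqrt
    refine squeeze_zero_norm (fun n => ?_) hsq
    have hpos := Q0_restr_single_pos hN hij n hω
    refine Real.abs_le_sqrt ?_
    rw [div_pow, div_le_div_iff₀ (by positivity) hpos]
    have := mul_le_mul_of_nonneg_right (B0_sq_le (restr (initialWord ω n) (Pi.single i 1))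
      (restr (initialWord ω n) e)) hpos.le
    linarith
  simp only [hsplit]
  simpa using ((hB.const_mul (2 * c)).const_add (c ^ 2)).add h0

end LinearForm

end EdgeAsymptotics

/-! ### The limit density and its Hölder continuity. -/

section HolderContinuity

variable {N : ℕ}

section Density

/-- The density on the edge `{i, j}` as a function of the slope, for boundary values `v` on a cell
where the coordinate functions have boundary values `e k`. -/
noncomputable def slopeDensity (i j : Fin (N + 1)) (v : Fin (N + 1) → ℝ)
    (e : Fin (N + 1) → Fin (N + 1) → ℝ) (s : ℝ) : ℝ :=
  edgeForm i j s v ^ 2 / ∑ k, edgeForm i j s (e k) ^ 2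

/-- Otherwise the form composed with `restr w` would vanish on a basis, contradicting surjectivity
of `restr w`. -/
theorem sum_edgeForm_restr_single_pos {i j : Fin (N + 1)} (hij : i ≠ j)
    (w : List (Fin (N + 1))) (s : ℝ) :
    0 < ∑ k, edgeForm i j s (restr w (Pi.single k 1)) ^ 2 := by
  refine lt_of_le_of_ne (Finset.sum_nonneg fun _ _ => sq_nonneg _) fun h => ?_
  have h0 := (Finset.sum_eq_zero_iff_of_nonneg fun _ _ => sq_nonneg _).1 h.symm
  obtain ⟨u, hu⟩ := restr_surjective w (Pi.single i 1)
  have h1 : (edgeFormₗ i j s ∘ₗ restr w) = 0 := by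
    refine LinearMap.pi_ext' fun k => LinearMap.ext_ring ?_
    exact pow_eq_zero_iff two_ne_zero |>.1 (h0 k (Finset.mem_univ k))
  have h2 := LinearMap.congr_fun h1 u
  have h3 : edgeForm i j s (restr w u) = 0 := h2
  rw [hu, edgeForm_single hij] at h3
  exact one_ne_zero h3

theorem exists_lipschitz_slopeDensity_exp {i j : Fin (N + 1)} (hij : i ≠ j)
    (w : List (Fin (N + 1))) (v : Fin (N + 1) → ℝ) (a : ℝ) :
    ∃ K : ℝ, 0 ≤ K ∧ ∀ s t : ℝ, |s| ≤ a → |t| ≤ a →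
      |slopeDensity i j v (fun k => restr w (Pi.single k 1)) (Real.exp s)
        - slopeDensity i j v (fun k => restr w (Pi.single k 1)) (Real.exp t)| ≤ K * |s - t| := by
  have hsmooth : ContDiff ℝ 1 fun s =>
      slopeDensity i j v (fun k => restr w (Pi.single k 1)) (Real.exp s) := by
    unfold slopeDensity edgeForm
    refine ContDiff.div (by fun_prop) (by fun_prop) fun s => ?_
    exact (sum_edgeForm_restr_single_pos hij w (Real.exp s)).ne'
  obtain ⟨K, hK⟩ := LocallyLipschitzOn.exists_lipschitzOnWith_of_compact
    (isCompact_Icc (a := -a) (b := a)) hsmooth.locallyLipschitz.locallyLipschitzOn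
  refine ⟨K, K.2, fun s t hs ht => ?_⟩
  simpa only [Real.dist_eq] using hK.dist_le_mul s (abs_le.1 hs) t (abs_le.1 ht)

theorem tendsto_cellRatio (hN : 2 ≤ N) (p : Fin (N + 1) → EuclideanSpace ℝ (Fin N))
    (hp : AffineIndependent ℝ p) {h : C(gasket p, ℝ)} (hh : IsHarmonic p h)
    (w : List (Fin (N + 1))) {i j : Fin (N + 1)} (hij : i ≠ j) {ω : ℕ → Fin (N + 1)}
    (hω : ω ∈ edgeSeq i j) :
    Tendsto (fun n => cellRatio p h (w ++ initialWord ω n)) atTop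
      (𝓝 (slopeDensity i j (restr w (cellVal p h [])) (fun k => restr w (Pi.single k 1))
        (Real.exp (logSlope i ω)))) := by
  have h1 := tendsto_Q0_ratio hN hij hω (restr w (cellVal p h []))
  have h2 := tendsto_finsetSum Finset.univ fun k _ =>
    tendsto_Q0_ratio hN hij hω (restr w (Pi.single k 1))
  refine (h1.div h2 (sum_edgeForm_restr_single_pos hij w _).ne').congr fun n => ?_
  have hpos := Q0_restr_single_pos hN hij n hω
  simp only [Pi.div_apply]
  rw [cellRatio_eq p hp hh, ← Finset.sum_div, div_div_div_cancel_right₀ hpos.ne']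
  simp only [restr_append]

end Density

section Holder

theorem two_rpow_holder (hN : 2 ≤ N) :
    (2 : ℝ) ^ Real.logb 2 (1 + 1 / (N : ℝ)) = 1 + 1 / (N : ℝ) :=
  Real.rpow_logb (by norm_num) (by norm_num) (by positivity)

theorem holder_exponent_pos (hN : 2 ≤ N) : 0 < Real.logb 2 (1 + 1 / (N : ℝ)) := by
  have hN' : (0 : ℝ) < N := by exact_mod_cast (by omega : 0 < N)
  exact Real.logb_pos (by norm_num) (by simpa using hN')

theorem ratio_mul_two_mul_rpow (hN : 2 ≤ N) {x : ℝ} (hx : 0 ≤ x) :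
    (N : ℝ) / ((N : ℝ) + 1) * (2 * x) ^ Real.logb 2 (1 + 1 / (N : ℝ))
      = x ^ Real.logb 2 (1 + 1 / (N : ℝ)) := by
  have hN' : (0 : ℝ) < N := by exact_mod_cast (by omega : 0 < N)
  rw [Real.mul_rpow (by norm_num) hx, two_rpow_holder hN, ← mul_assoc]
  have : (N : ℝ) / ((N : ℝ) + 1) * (1 + 1 / (N : ℝ)) = 1 := by
    field_simp
  rw [this, one_mul]

variable {p : Fin (N + 1) → EuclideanSpace ℝ (Fin N)}
  {b : Fin (N + 1) → (EuclideanSpace ℝ (Fin N) →ᵃ[ℝ] ℝ)}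

theorem coord_code_eq (hb : ∀ i j, b i (p j) = if i = j then 1 else 0) (k : Fin (N + 1))
    (ω : ℕ → Fin (N + 1)) :
    b k (code p ω) = (b k (code p (shift ω)) + if k = ω 0 then 1 else 0) / 2 := by
  rw [code_eq, coord_psi, hb]

/-- While the letter is `k`, the shift doubles `1 - b k`, and `(N/(N+1)) 2^α = 1` keeps the bound
invariant. At the first other letter `1 - b k ≥ 1/2`, and since `2^α = 1 + 1/N` the trivial bound `2
log N` suffices. The last term covers stopping after `n` letters and tends to `0`. -/
theorem abs_logSlope_sub_const_le (hN : 2 ≤ N) (hb : ∀ i j, b i (p j) = if i = j then 1 else 0)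
    (hs : ∀ z, ∑ i, b i z = 1) (i k : Fin (N + 1)) (n : ℕ) (ω : ℕ → Fin (N + 1)) :
    |logSlope i ω - logSlope i (fun _ => k)|
      ≤ 2 * Real.log N * (1 + 1 / (N : ℝ)) *
          (1 - b k (code p ω)) ^ Real.logb 2 (1 + 1 / (N : ℝ))
        + 2 * Real.log N * ((N : ℝ) / ((N : ℝ) + 1)) ^ n := by
  have hlog : 0 ≤ Real.log N := Real.log_natCast_nonneg N
  have htriv : ∀ ω η : ℕ → Fin (N + 1), |logSlope i ω - logSlope i η| ≤ 2 * Real.log N := by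
    intro ω η
    have h1 := abs_le.1 (abs_logSlope_le hN i ω)
    have h2 := abs_le.1 (abs_logSlope_le hN i η)
    exact abs_le.2 ⟨by linarith, by linarith⟩
  induction n generalizing ω with
  | zero =>
    have h1 : 0 ≤ 1 - b k (code p ω) := by linarith [coord_code_le_one p hb hs k ω]
    have := htriv ω fun _ => k
    have h2 : 0 ≤ 2 * Real.log N * (1 + 1 / (N : ℝ)) *
          (1 - b k (code p ω)) ^ Real.logb 2 (1 + 1 / (N : ℝ)) := by positivity
    rw [pow_zero]
    linarith
  | succ n ih =>
    have h1 : 0 ≤ 1 - b k (code p ω) := by linarith [coord_code_le_one p hb hs k ω]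
    have hk := coord_code_eq hb k ω
    by_cases h0 : ω 0 = k
    · rw [if_pos h0.symm] at hk
      have hd : 1 - b k (code p (shift ω)) = 2 * (1 - b k (code p ω)) := by
        rw [hk]
        ring
      have hstep := abs_logSlope_sub_le_of_eq hN i (ω := ω) (η := fun _ => k) h0
      refine hstep.trans ((mul_le_mul_of_nonneg_left (ih (shift ω)) (by positivity)).trans_eq ?_)
      rw [hd, mul_add, mul_left_comm, ratio_mul_two_mul_rpow hN h1, pow_succ]
      ring
    · rw [if_neg fun e => h0 e.symm] at hk
      have hhalf : 1 ≤ 2 * (1 - b k (code p ω)) := by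
        rw [hk]
        linarith [coord_code_le_one p hb hs k (shift ω)]
      have hpow : 1 ≤ (1 + 1 / (N : ℝ)) *
          (1 - b k (code p ω)) ^ Real.logb 2 (1 + 1 / (N : ℝ)) := by
        have := Real.one_le_rpow hhalf (holder_exponent_pos hN).le
        rwa [Real.mul_rpow (by norm_num) h1, two_rpow_holder hN] at this
      have h2 := mul_le_mul_of_nonneg_left hpow (show 0 ≤ 2 * Real.log N by positivity)
      have h3 : 0 ≤ 2 * Real.log N * ((N : ℝ) / ((N : ℝ) + 1)) ^ (n + 1) := by positivity
      rw [mul_assoc (2 * Real.log N)]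
      linarith [htriv ω fun _ => k]

theorem abs_logSlope_sub_const_le_rpow (hN : 2 ≤ N)
    (hb : ∀ i j, b i (p j) = if i = j then 1 else 0) (hs : ∀ z, ∑ i, b i z = 1)
    (i k : Fin (N + 1)) (ω : ℕ → Fin (N + 1)) :
    |logSlope i ω - logSlope i (fun _ => k)|
      ≤ 2 * Real.log N * (1 + 1 / (N : ℝ)) *
          (1 - b k (code p ω)) ^ Real.logb 2 (1 + 1 / (N : ℝ)) := by
  have hlim : Tendsto (fun n : ℕ => 2 * Real.log N * (1 + 1 / (N : ℝ)) *
          (1 - b k (code p ω)) ^ Real.logb 2 (1 + 1 / (N : ℝ))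
        + 2 * Real.log N * ((N : ℝ) / ((N : ℝ) + 1)) ^ n) atTop (𝓝 (2 * Real.log N *
        (1 + 1 / (N : ℝ)) * (1 - b k (code p ω)) ^ Real.logb 2 (1 + 1 / (N : ℝ)))) := by
    simpa using ((tendsto_pow_atTop_nhds_zero_of_lt_one (by positivity)
      (holder_ratio_lt_one (N := N))).const_mul (2 * Real.log N)).const_add _
  exact ge_of_tendsto' hlim fun n => abs_logSlope_sub_const_le hN hb hs i k n ω

/-- Two sequences that start with different letters are compared through the junction point. -/
theorem abs_logSlope_sub_le_of_junction (hN : 2 ≤ N)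
    (hb : ∀ i j, b i (p j) = if i = j then 1 else 0) (hs : ∀ z, ∑ i, b i z = 1)
    {i j : Fin (N + 1)} (hij : i ≠ j) {ω η : ℕ → Fin (N + 1)} (hω : ω 0 = i) (hη : η 0 = j) :
    |logSlope i ω - logSlope i η|
      ≤ 2 * (2 * Real.log N * (1 + 1 / (N : ℝ))) *
          (|b i (code p ω) - b i (code p η)| + |b j (code p ω) - b j (code p η)|)
            ^ Real.logb 2 (1 + 1 / (N : ℝ)) := by
  set α := Real.logb 2 (1 + 1 / (N : ℝ)) with hα
  set Δ := |b i (code p ω) - b i (code p η)| + |b j (code p ω) - b j (code p η)| with hΔ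
  set C := 2 * Real.log N * (1 + 1 / (N : ℝ)) with hC
  have hlog : 0 ≤ Real.log N := Real.log_natCast_nonneg N
  have hC0 : 0 ≤ C := by positivity
  have hΔ0 : 0 ≤ Δ := by positivity
  have hα0 : 0 ≤ α := (holder_exponent_pos hN).le
  have e1 := coord_code_eq hb j ω
  have e2 := coord_code_eq hb j η
  have e3 := coord_code_eq hb i ω
  have e4 := coord_code_eq hb i η
  rw [hω, if_neg hij.symm] at e1
  rw [hη, if_pos rfl] at e2
  rw [hω, if_pos rfl] at e3
  rw [hη, if_neg hij] at e4
  have b1 := coord_code_nonneg p hb j (shift η)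
  have b2 := coord_code_nonneg p hb i (shift ω)
  have b3 := coord_code_le_one p hb hs j (shift ω)
  have b4 := coord_code_le_one p hb hs i (shift η)
  have g1 := abs_nonneg (b i (code p ω) - b i (code p η))
  have g2 := abs_nonneg (b j (code p ω) - b j (code p η))
  have g3 := le_abs_self (b i (code p ω) - b i (code p η))
  have g4 := neg_abs_le (b j (code p ω) - b j (code p η))
  -- At the junction the tails are the vertices `p_j` and `p_i`. The `j`-coordinates of the two
  -- points lie on opposite sides of `1/2`, so their gap bounds the distance of each from `1/2`;
  -- likewise for `i`.
  have d1 : 1 - b j (code p (shift ω)) ≤ 2 * Δ := by linarith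
  have d2 : 1 - b i (code p (shift η)) ≤ 2 * Δ := by linarith
  have h1 : |logSlope i ω| ≤ C * Δ ^ α := by
    have h := abs_logSlope_sub_le_of_eq hN i (ω := ω) (η := seqCons i fun _ => j) hω
    rw [logSlope_seqCons_self hN hij, sub_zero, shift_seqCons] at h
    refine h.trans ((mul_le_mul_of_nonneg_left
      (abs_logSlope_sub_const_le_rpow hN hb hs i j (shift ω)) (by positivity)).trans ?_)
    rw [← ratio_mul_two_mul_rpow hN hΔ0, mul_left_comm]
    gcongr
  have h2 : |logSlope i η| ≤ C * Δ ^ α := by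
    have h := abs_logSlope_sub_le_of_eq hN i (ω := η) (η := seqCons j fun _ => i) hη
    rw [logSlope_seqCons_of_ne hN hij, sub_zero, shift_seqCons] at h
    refine h.trans ((mul_le_mul_of_nonneg_left
      (abs_logSlope_sub_const_le_rpow hN hb hs i i (shift η)) (by positivity)).trans ?_)
    rw [← ratio_mul_two_mul_rpow hN hΔ0, mul_left_comm]
    gcongr
  have := abs_sub (logSlope i ω) (logSlope i η)
  linarith

theorem abs_logSlope_sub_le (hN : 2 ≤ N)
    (hb : ∀ i j, b i (p j) = if i = j then 1 else 0) (hs : ∀ z, ∑ i, b i z = 1)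
    {i j : Fin (N + 1)} (hij : i ≠ j) (n : ℕ) {ω η : ℕ → Fin (N + 1)} (hω : ω ∈ edgeSeq i j)
    (hη : η ∈ edgeSeq i j) :
    |logSlope i ω - logSlope i η|
      ≤ 2 * (2 * Real.log N * (1 + 1 / (N : ℝ))) *
          (|b i (code p ω) - b i (code p η)| + |b j (code p ω) - b j (code p η)|)
            ^ Real.logb 2 (1 + 1 / (N : ℝ))
        + 2 * Real.log N * ((N : ℝ) / ((N : ℝ) + 1)) ^ n := by
  have hlog : 0 ≤ Real.log N := Real.log_natCast_nonneg N
  induction n generalizing ω η with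
  | zero =>
    have h1 := abs_le.1 (abs_logSlope_le hN i ω)
    have h2 := abs_le.1 (abs_logSlope_le hN i η)
    rw [pow_zero, mul_one]
    refine le_add_of_nonneg_of_le (by positivity) (abs_le.2 ⟨by linarith, by linarith⟩)
  | succ n ih =>
    by_cases h0 : ω 0 = η 0
    · have hd : ∀ k, |b k (code p (shift ω)) - b k (code p (shift η))|
          = 2 * |b k (code p ω) - b k (code p η)| := by
        intro k
        rw [coord_code_eq hb k ω, coord_code_eq hb k η, h0, ← sub_div, add_sub_add_right_eq_sub,
          abs_div, abs_two]
        ring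
      refine (abs_logSlope_sub_le_of_eq hN i h0).trans ((mul_le_mul_of_nonneg_left
        (ih (shift_mem_edgeSeq hω) (shift_mem_edgeSeq hη)) (by positivity)).trans_eq ?_)
      rw [hd, hd, ← mul_add 2, mul_add, mul_left_comm, ratio_mul_two_mul_rpow hN (by positivity),
        pow_succ]
      ring
    · refine le_add_of_le_of_nonneg ?_ (by positivity)
      rcases hω 0 with h1 | h1 <;> rcases hη 0 with h2 | h2
      · exact absurd (h1.trans h2.symm) h0
      · exact abs_logSlope_sub_le_of_junction hN hb hs hij h1 h2
      · rw [abs_sub_comm, abs_sub_comm (b i _), abs_sub_comm (b j _)]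
        exact abs_logSlope_sub_le_of_junction hN hb hs hij h2 h1
      · exact absurd (h1.trans h2.symm) h0

theorem exists_holder_logSlope (hN : 2 ≤ N) (p : Fin (N + 1) → EuclideanSpace ℝ (Fin N))
    (hp : AffineIndependent ℝ p) {i j : Fin (N + 1)} (hij : i ≠ j) :
    ∃ C : ℝ, 0 ≤ C ∧ ∀ ω ∈ edgeSeq i j, ∀ η ∈ edgeSeq i j, |logSlope i ω - logSlope i η|
      ≤ C * dist (code p ω) (code p η) ^ Real.logb 2 (1 + 1 / (N : ℝ)) := by
  obtain ⟨b, hb, hs⟩ := exists_affineMap_coord p hp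
  have hlog : 0 ≤ Real.log N := Real.log_natCast_nonneg N
  set A := 2 * (2 * Real.log N * (1 + 1 / (N : ℝ))) with hA
  have hA0 : 0 ≤ A := by positivity
  have hlip : ∀ k, ∃ c : ℝ, 0 ≤ c ∧ ∀ x y, |b k x - b k y| ≤ c * dist x y := by
    intro k
    refine ⟨‖LinearMap.toContinuousLinearMap (b k).linear‖, norm_nonneg _, fun x y => ?_⟩
    have h := (LinearMap.toContinuousLinearMap (b k).linear).le_opNorm (x - y)
    have e : (LinearMap.toContinuousLinearMap (b k).linear) (x - y) = b k x - b k y := by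
      have := (b k).linearMap_vsub x y
      simpa using this
    rwa [e, ← dist_eq_norm x y, Real.norm_eq_abs] at h
  obtain ⟨c, hc0, hc⟩ := hlip i
  obtain ⟨d, hd0, hd⟩ := hlip j
  have hα0 := (holder_exponent_pos hN).le
  refine ⟨A * (c + d) ^ Real.logb 2 (1 + 1 / (N : ℝ)), by positivity, fun ω hω η hη => ?_⟩
  have hlim : Tendsto (fun n : ℕ => A *
          (|b i (code p ω) - b i (code p η)| + |b j (code p ω) - b j (code p η)|)
            ^ Real.logb 2 (1 + 1 / (N : ℝ))
        + 2 * Real.log N * ((N : ℝ) / ((N : ℝ) + 1)) ^ n) atTop (𝓝 (A *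
          (|b i (code p ω) - b i (code p η)| + |b j (code p ω) - b j (code p η)|)
            ^ Real.logb 2 (1 + 1 / (N : ℝ)))) := by
    simpa using ((tendsto_pow_atTop_nhds_zero_of_lt_one (by positivity)
      (holder_ratio_lt_one (N := N))).const_mul (2 * Real.log N)).const_add _
  refine (ge_of_tendsto' hlim fun n => abs_logSlope_sub_le hN hb hs hij n hω hη).trans ?_
  rw [mul_assoc A, ← Real.mul_rpow (by positivity) dist_nonneg, add_mul]
  gcongr
  · exact hc _ _
  · exact hd _ _

end Holder

section Edge

variable (p : Fin (N + 1) → EuclideanSpace ℝ (Fin N))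

theorem psi_mem_segment {i j k : Fin (N + 1)} (hk : k = i ∨ k = j) {z : EuclideanSpace ℝ (Fin N)}
    (hz : z ∈ segment ℝ (p i) (p j)) : psi p k z ∈ segment ℝ (p i) (p j) := by
  have hpk : p k ∈ segment ℝ (p i) (p j) := by
    rcases hk with rfl | rfl
    · exact left_mem_segment ℝ _ _
    · exact right_mem_segment ℝ _ _
  have := (convex_segment (𝕜 := ℝ) (p i) (p j)) hz hpk
    (show (0 : ℝ) ≤ 1 / 2 by norm_num) (show (0 : ℝ) ≤ 1 / 2 by norm_num) (by norm_num)
  simpa only [psi, smul_add] using this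

theorem code_mem_segment {i j : Fin (N + 1)} {ω : ℕ → Fin (N + 1)} (hω : ω ∈ edgeSeq i j) :
    code p ω ∈ segment ℝ (p i) (p j) := by
  have hcl : IsClosed (segment ℝ (p i) (p j)) := by
    rw [← convexHull_pair]
    exact ((Set.toFinite _).isCompact_convexHull ℝ).isClosed
  have hmem : ∀ (n : ℕ) (ω : ℕ → Fin (N + 1)), ω ∈ edgeSeq i j →
      psiWord p (initialWord ω n) (p i) ∈ segment ℝ (p i) (p j) := by
    intro n
    induction n with
    | zero => exact fun _ _ => left_mem_segment ℝ _ _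
    | succ n ih =>
      intro ω hω
      rw [initialWord_succ, psiWord_cons]
      exact psi_mem_segment p (hω 0) (ih _ (shift_mem_edgeSeq hω))
  exact hcl.mem_of_tendsto (tendsto_psiWord_initialWord p ω (p i))
    (Eventually.of_forall fun n => hmem n ω hω)

theorem exists_psi_eq_of_mem_segment {i j : Fin (N + 1)} {x : EuclideanSpace ℝ (Fin N)}
    (hx : x ∈ segment ℝ (p i) (p j)) :
    ∃ k ∈ ({i, j} : Set (Fin (N + 1))), ∃ y ∈ segment ℝ (p i) (p j), x = psi p k y := by
  rw [segment_eq_image] at hx ⊢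
  obtain ⟨t, ⟨ht0, ht1⟩, rfl⟩ := hx
  -- The segment is the union of its two halves, the images of itself under `psi p i` and `psi p j`;
  -- the parameter becomes `2t` or `2t - 1`.
  by_cases h : t ≤ 1 / 2
  · refine ⟨i, Or.inl rfl, _, ⟨2 * t, ⟨by linarith, by linarith⟩, rfl⟩, ?_⟩
    simp only [psi]
    module
  · refine ⟨j, Or.inr rfl, _, ⟨2 * t - 1, ⟨by linarith, by linarith⟩, rfl⟩, ?_⟩
    simp only [psi]
    module

theorem exists_edgeSeq_code_eq {i j : Fin (N + 1)} {x : EuclideanSpace ℝ (Fin N)}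
    (hx : x ∈ segment ℝ (p i) (p j)) : ∃ ω ∈ edgeSeq i j, code p ω = x := by
  have hb : Bornology.IsBounded (segment ℝ (p i) (p j)) := by
    rw [← convexHull_pair]
    exact ((Set.toFinite _).isCompact_convexHull ℝ).isBounded
  obtain ⟨ω, hω, h⟩ := exists_code_eq_of_selfSimilar p hb {i, j}
    (fun x hx => exists_psi_eq_of_mem_segment p hx) hx
  exact ⟨ω, hω, h⟩

end Edge

end HolderContinuity

end SierpinskiGasket

/-! ### Assembly of the theorem. -/

open SierpinskiGasket in
theorem SierpinskiGasket.edge_density_of_two_le (N : ℕ) (hN : 2 ≤ N)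
    (p : Fin (N + 1) → EuclideanSpace ℝ (Fin N)) (hp : AffineIndependent ℝ p)
    (w : List (Fin (N + 1))) (i j : Fin (N + 1)) (hij : i ≠ j)
    (h : C(gasket p, ℝ)) (hh : IsHarmonic p h) :
    ∃ δ : edge p w i j → ℝ,
      (∀ ω ∈ edgeSeq i j, ∀ x : edge p w i j, IsCodedBy p w ω x →
        Tendsto (fun n => cellRatio p h (w ++ initialWord ω n)) atTop (𝓝 (δ x))) ∧
      ∃ C : ℝ, ∀ x y : edge p w i j,
        |δ x - δ y| ≤ C * dist x y ^ Real.logb 2 (1 + 1 / (N : ℝ)) := by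
  have hex : ∀ x : edge p w i j, ∃ ω ∈ edgeSeq i j, psiWord p w (code p ω) = x := by
    rintro ⟨_, z, hz, rfl⟩
    obtain ⟨ω, hω, hωz⟩ := exists_edgeSeq_code_eq p hz
    exact ⟨ω, hω, congrArg _ hωz⟩
  choose c hc hcx using hex
  obtain ⟨A, hA0, hA⟩ := exists_holder_logSlope hN p hp hij
  obtain ⟨K, hK0, hK⟩ := exists_lipschitz_slopeDensity_exp hij w (restr w (cellVal p h []))
    (Real.log N)
  refine ⟨fun x => slopeDensity i j (restr w (cellVal p h []))
    (fun k => restr w (Pi.single k 1)) (Real.exp (logSlope i (c x))), ?_, ?_⟩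
  · intro ω hω x hx
    have hcode : code p ω = code p (c x) :=
      psiWord_injective p w (hx.eq.symm.trans (hcx x).symm)
    -- The Hölder estimate at distance zero shows that the log slope does not depend on the chosen
    -- code `c x`; positivity of the exponent is what makes the right side vanish.
    have h0 := hA ω hω (c x) (hc x)
    rw [hcode, dist_self, Real.zero_rpow (holder_exponent_pos hN).ne', mul_zero] at h0
    beta_reduce
    rw [← sub_eq_zero.1 (abs_nonpos_iff.1 h0)]
    exact tendsto_cellRatio hN p hp hh w hij hω
  -- The power of `2 ^ w.length` undoes the contraction of distances by `psiWord p w`.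
  · refine ⟨K * (A * (2 ^ w.length) ^ Real.logb 2 (1 + 1 / (N : ℝ))), fun x y => ?_⟩
    refine (hK _ _ (abs_logSlope_le hN i _) (abs_logSlope_le hN i _)).trans ?_
    rw [mul_assoc]
    refine mul_le_mul_of_nonneg_left ((hA _ (hc x) _ (hc y)).trans_eq ?_) hK0
    have hd := dist_psiWord p w (code p (c x)) (code p (c y))
    rw [hcx, hcx, ← Subtype.dist_eq] at hd
    rw [mul_assoc, ← Real.mul_rpow (by positivity) dist_nonneg, hd, ← mul_assoc, ← mul_pow]
    norm_num

open SierpinskiGasket in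
theorem theorem2p4 (N : ℕ) (hN : N = 2 ∨ N = 3)
    (p : Fin (N + 1) → EuclideanSpace ℝ (Fin N)) (hp : AffineIndependent ℝ p)
    (w : List (Fin (N + 1))) (i j : Fin (N + 1)) (hij : i ≠ j)
    (h : C(SierpinskiGasket.gasket p, ℝ)) (hh : SierpinskiGasket.IsHarmonic p h) :
    (∀ ω ∈ SierpinskiGasket.edgeSeq i j, ∃ x ∈ SierpinskiGasket.edge p w i j,
      SierpinskiGasket.IsCodedBy p w ω x) ∧
    (∀ x ∈ SierpinskiGasket.edge p w i j, ∃ ω ∈ SierpinskiGasket.edgeSeq i j,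
      SierpinskiGasket.IsCodedBy p w ω x) ∧
    (∀ ω ∈ SierpinskiGasket.edgeSeq i j, ∃ l : ℝ,
      Tendsto (fun n => SierpinskiGasket.cellRatio p h (w ++ SierpinskiGasket.initialWord ω n))
        atTop (𝓝 l)) ∧
    ∃ δ : SierpinskiGasket.edge p w i j → ℝ,
      (∀ ω ∈ SierpinskiGasket.edgeSeq i j, ∀ x : SierpinskiGasket.edge p w i j,
        SierpinskiGasket.IsCodedBy p w ω x →
        Tendsto (fun n => SierpinskiGasket.cellRatio p h (w ++ SierpinskiGasket.initialWord ω n))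
          atTop (𝓝 (δ x))) ∧
      ∃ C : ℝ, ∀ x y : SierpinskiGasket.edge p w i j,
        |δ x - δ y| ≤ C * dist x y ^ Real.logb 2 (1 + 1 / (N : ℝ)) := by
  have hN2 : 2 ≤ N := by omega
  refine ⟨fun ω hω => ?_, ?_, fun ω hω => ?_, ?_⟩
  · exact ⟨_, ⟨_, code_mem_segment p hω, rfl⟩, isCodedBy_code p w ω⟩
  · rintro _ ⟨z, hz, rfl⟩
    obtain ⟨ω, hω, rfl⟩ := exists_edgeSeq_code_eq p hz
    exact ⟨ω, hω, isCodedBy_code p w ω⟩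
  · exact ⟨_, tendsto_cellRatio hN2 p hp hh w hij hω⟩
  · exact edge_density_of_two_le N hN2 p hp w i j hij h hh
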